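/- **Conventions.** Trees are finite rooted non-planar trees with open-ended edges: every vertex has one outgoing edge and finitely many (possibly zero) incoming edges, and one edge is the root. For a tree $T$, $V(T)$ is its set of vertices and $\Omega(T)$ is the coloured symmetric operad whose colours are the edges of $T$ and whose operations are freely generated by the vertices; thus there is an operation with inputs $e_1,\dots,e_n$ and output $e$ (and then exactly one) iff $e_1,\dots,e_n$ is an enumeration without repetition of the leaves of a subtree $T_\sigma\subseteq T$ with root $e$, where $\sigma=(e_1,\dots,e_n;e)$. The category $\Omega$ has trees as objects and operad maps $\Omega(R)\to\Omega(T)$ as morphisms. A dendroidal set is a presheaf $X$ on $\Omega$, the elements of $X_T$ are its dendrices of shape $T$, and $\Omega[T]$ is the representable presheaf of $T$. If $i_k\colon\Omega_k\to\Omega$ is the inclusion of the full subcategory of trees with at most $k$ vertices, then $\mathrm{Sk}_k=(i_k)_!\,i_k^*$ (restriction followed by its left adjoint), and the $k$-skeleton $\mathrm{Sk}_k(t)$ of a dendrex $t\in X_T$ is the composite $\mathrm{Sk}_k(\Omega[T])\to\Omega[T]\xrightarrow{\,t\,}X$ of the canonical map with the map corresponding to $t$ under the Yoneda lemma. Let $H$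 be the category with two objects $0,1$ and exactly one morphism between any two objects. The operad $W\Omega(T)$, enriched in categories, has the edges of $T$ as colours, and its category of operations of signature $\sigma$ is $\prod_{f}H$, the product over the inner edges $f$ of $T_\sigma$, if $T_\sigma$ exists, and is empty otherwise; in a composite the inner edges of the pieces keep their coordinates and the edges along which non-trivial subtrees are grafted get the coordinate $1$. A map $\delta\colon R\to T$ of $\Omega$ induces $W\Omega(R)\to W\Omega(T)$: the coordinate at an inner edge $g$ of the image subtree is the maximum of the coordinates at the inner edges mapped to $g$ by $\delta$ (and $0$ if there are none). Let $\mathfrak{Cat}$ be the operad enriched in categories whose colours are the small categories and whose category of operations from $X_1,\dots,X_n$ to $X$ is the category of functors $X_1\times\cdots\times X_n\to X$ and natural transformations. Finally, let $\mathrm{wCat}^1$ be the dendroidal set with $\mathrm{wCat}^1_T=\mathrm{Hom}(W\Omega(T),\mathfrak{Cat})$, the set of maps of operads enriched in categories (the homotopy coherent dendroidal nerve of $\mathfrak{Cat}$). **Proposition.** Let $T$ be a tree with $|V(T)|\ge 3$. If $t,s\in\mathrm{wCat}^1_T$ satisfy $\mathrm{Sk}_2(t)=\mathrm{Sk}_2(s)$,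 then $t=s$. -/

import Mathlib

open CategoryTheory

set_option linter.checkUnivs false

universe u v w

/-- Two functors into a thin category that agree on objects are equal. -/
theorem functor_ext_of_thin {A : Type*} [Category A] {B : Type*} [Category B] [Quiver.IsThin B]
    {F G : A ⥤ B} (h : ∀ a, F.obj a = G.obj a) : F = G :=
  CategoryTheory.Functor.ext h (fun _ _ _ => Subsingleton.elim _ _)

/-! ## Coloured symmetric operads enriched in categories -/

/-- A (coloured, symmetric) operad enriched in the cartesian monoidal category of categories,
in coordinate-free form: operations have inputs indexed by an arbitrary finite set `X`
(an ordered sequence of inputs is the case `X = Fin n`), bijections of the index sets act by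
relabelling the inputs, and composition is the simultaneous one. -/
structure CatOperad where
  /-- the colours (objects) -/
  Color : Type u
  /-- the category of operations with inputs `c x`, `x ∈ X`, and output `e` -/
  Op : {X : Type} → [Finite X] → (X → Color) → Color → Type w
  [cat : ∀ {X : Type} [Finite X] (c : X → Color) (e : Color), Category.{v} (Op c e)]
  /-- the identity operation of a colour -/
  unit : ∀ e : Color, Op (fun _ : Unit => e) e
  /-- the symmetries -/
  relabel : ∀ {X Y : Type} [Finite X] [Finite Y] (φ : X ≃ Y) (c : Y → Color) (e : Color),
    Op (c ∘ φ) e ⥤ Op c e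
  /-- the composition -/
  comp : ∀ {X : Type} [Finite X] {Y : X → Type} [∀ x, Finite (Y x)] (c : X → Color) (e : Color)
    (d : ∀ x, Y x → Color),
    (Op c e × ∀ x, Op (d x) (c x)) ⥤ Op (fun p : Σ x, Y x => d p.1 p.2) e
  relabel_refl : ∀ {X : Type} [Finite X] (c : X → Color) (e : Color),
    relabel (Equiv.refl X) c e = 𝟭 (Op c e)
  relabel_trans : ∀ {X Y Z : Type} [Finite X] [Finite Y] [Finite Z] (φ : X ≃ Y) (ψ : Y ≃ Z)
    (c : Z → Color) (e : Color),
    relabel φ (c ∘ ψ) e ⋙ relabel ψ c e = relabel (φ.trans ψ) c e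
  /-- equivariance of the composition in the outer operation -/
  comp_relabel_left : ∀ {X X' : Type} [Finite X] [Finite X'] {Y : X' → Type} [∀ x, Finite (Y x)]
    (φ : X ≃ X') (c : X' → Color) (e : Color) (d : ∀ x, Y x → Color),
    (relabel φ c e).prod (𝟭 (∀ x, Op (d x) (c x))) ⋙ comp c e d =
      (𝟭 (Op (c ∘ φ) e)).prod (Functor.pi' fun x => Pi.eval (fun x' => Op (d x') (c x')) (φ x)) ⋙
        comp (c ∘ φ) e (fun x => d (φ x)) ⋙
          relabel (Equiv.sigmaCongrLeft (β := Y) φ) (fun p : Σ x, Y x => d p.1 p.2) e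
  /-- equivariance of the composition in the inner operations -/
  comp_relabel_right : ∀ {X : Type} [Finite X] {Y Y' : X → Type} [∀ x, Finite (Y x)]
    [∀ x, Finite (Y' x)] (ψ : ∀ x, Y x ≃ Y' x) (c : X → Color) (e : Color)
    (d : ∀ x, Y' x → Color),
    (𝟭 (Op c e)).prod (Functor.pi fun x => relabel (ψ x) (d x) (c x)) ⋙ comp c e d =
      comp c e (fun x => d x ∘ ψ x) ⋙
        relabel (Equiv.sigmaCongrRight ψ) (fun p : Σ x, Y' x => d p.1 p.2) e
  unit_comp : ∀ {X : Type} [Finite X] (c : X → Color) (e : Color),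
    Functor.prod' ((Functor.const (Op c e)).obj (unit e)) (Functor.pi' fun _ : Unit => 𝟭 (Op c e)) ⋙
      comp (fun _ : Unit => e) e (fun _ => c) ⋙ relabel (Equiv.uniqueSigma fun _ : Unit => X) c e =
        𝟭 (Op c e)
  comp_unit : ∀ {X : Type} [Finite X] (c : X → Color) (e : Color),
    Functor.prod' (𝟭 (Op c e)) ((Functor.const (Op c e)).obj fun x => unit (c x)) ⋙
      comp c e (fun x (_ : Unit) => c x) ⋙ relabel (Equiv.sigmaPUnit X) c e = 𝟭 (Op c e)
  assoc : ∀ {X : Type} [Finite X] {Y : X → Type} [∀ x, Finite (Y x)] {Z : ∀ x, Y x → Type}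
    [∀ x y, Finite (Z x y)] (c : X → Color) (e : Color) (d : ∀ x, Y x → Color)
    (b : ∀ x y, Z x y → Color),
    (comp c e d).prod (𝟭 (∀ p : Σ x, Y x, Op (b p.1 p.2) (d p.1 p.2))) ⋙
      comp (fun p : Σ x, Y x => d p.1 p.2) e (fun p => b p.1 p.2) ⋙
        relabel (Equiv.sigmaAssoc Z) (fun q : Σ x, Σ y, Z x y => b q.1 q.2.1 q.2.2) e =
    Functor.prod' (CategoryTheory.Prod.fst _ _ ⋙ CategoryTheory.Prod.fst _ _)
      (Functor.pi' fun x => Functor.prod'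
        (CategoryTheory.Prod.fst _ _ ⋙ CategoryTheory.Prod.snd _ _ ⋙ Pi.eval (fun x => Op (d x) (c x)) x)
        (CategoryTheory.Prod.snd _ _ ⋙ Functor.pi' fun y =>
          Pi.eval (fun p : Σ x, Y x => Op (b p.1 p.2) (d p.1 p.2)) ⟨x, y⟩) ⋙
        comp (d x) (c x) (b x)) ⋙
      comp c e (fun x (q : Σ y, Z x y) => b x q.1 q.2)

attribute [instance] CatOperad.cat

namespace CatOperad

universe u' w' v' u'' w'' v''

/-- Maps of operads enriched in categories. -/
structure Hom (P : CatOperad.{u, w, v}) (Q : CatOperad.{u', w', v'}) where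
  color : P.Color → Q.Color
  app : ∀ {X : Type} [Finite X] (c : X → P.Color) (e : P.Color),
    P.Op c e ⥤ Q.Op (color ∘ c) (color e)
  app_unit : ∀ e : P.Color, (app (fun _ : Unit => e) e).obj (P.unit e) = Q.unit (color e)
  app_relabel : ∀ {X Y : Type} [Finite X] [Finite Y] (φ : X ≃ Y) (c : Y → P.Color) (e : P.Color),
    P.relabel φ c e ⋙ app c e = app (c ∘ φ) e ⋙ Q.relabel φ (color ∘ c) (color e)
  app_comp : ∀ {X : Type} [Finite X] {Y : X → Type} [∀ x, Finite (Y x)] (c : X → P.Color)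
    (e : P.Color) (d : ∀ x, Y x → P.Color),
    P.comp c e d ⋙ app (fun p : Σ x, Y x => d p.1 p.2) e =
      (app c e).prod (Functor.pi fun x => app (d x) (c x)) ⋙
        Q.comp (color ∘ c) (color e) (fun x => color ∘ d x)

namespace Hom

/-- The identity map of an operad. -/
def id (P : CatOperad.{u, w, v}) : Hom P P where
  color := fun c => c
  app c e := 𝟭 (P.Op c e)
  app_unit _ := rfl
  app_relabel _ _ _ := rfl
  app_comp _ _ _ := rfl

/-- The composite of `F : P → Q` and `G : Q → R`. -/
def comp {P : CatOperad.{u, w, v}} {Q : CatOperad.{u', w', v'}} {R : CatOperad.{u'', w'', v''}}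
    (F : Hom P Q) (G : Hom Q R) : Hom P R where
  color := G.color ∘ F.color
  app c e := F.app c e ⋙ G.app (F.color ∘ c) (F.color e)
  app_unit e := by
    have h := congrArg (G.app (F.color ∘ fun _ : Unit => e) (F.color e)).obj (F.app_unit e)
    exact h.trans (G.app_unit (F.color e))
  app_relabel φ c e := by
    have h := congrArg (· ⋙ G.app (F.color ∘ c) (F.color e)) (F.app_relabel φ c e)
    have h' := congrArg (F.app (c ∘ φ) e ⋙ ·) (G.app_relabel φ (F.color ∘ c) (F.color e))
    exact h.trans h'
  app_comp {X} _ {Y} _ c e d := by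
    have h := congrArg (· ⋙ G.app (F.color ∘ fun p : Σ x, Y x => d p.1 p.2) (F.color e))
      (F.app_comp c e d)
    have h' := congrArg ((F.app c e).prod (Functor.pi fun x => F.app (d x) (c x)) ⋙ ·)
      (G.app_comp (F.color ∘ c) (F.color e) (fun x => F.color ∘ d x))
    exact h.trans h'

theorem ext' {P : CatOperad.{u, w, v}} {Q : CatOperad.{u', w', v'}} {F G : Hom P Q}
    (h : F.color = G.color)
    (h' : ∀ {X : Type} [Finite X] (c : X → P.Color) (e : P.Color), HEq (F.app c e) (G.app c e)) :
    F = G := by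
  cases F with | mk f F _ _ _ =>
  cases G with | mk g G _ _ _ =>
  obtain rfl : f = g := h
  obtain rfl : @F = @G := by
    funext X _ c e
    exact eq_of_heq (h' c e)
  rfl

theorem nonempty_op {P : CatOperad.{u, w, v}} {Q : CatOperad.{u', w', v'}} (F : Hom P Q) {X : Type}
    [Finite X] {c : X → P.Color} {e : P.Color} (h : Nonempty (P.Op c e)) :
    Nonempty (Q.Op (F.color ∘ c) (F.color e)) :=
  h.map (F.app c e).obj

end Hom

end CatOperad

/-! ## The operad of small categories -/

/-- The operad of small categories: the operations from `(c x)ₓ` to `e` are the functors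
`∏ₓ c x ⥤ e`, and the morphisms of operations are the natural transformations. -/
def Ctg : CatOperad.{max (u + 1) (v + 1), max u v, max u v} where
  Color := Cat.{v, u}
  Op c e := (∀ x, c x) ⥤ e
  unit e := Pi.eval (fun _ : Unit => (e : Type u)) ()
  relabel φ c e :=
    (Functor.whiskeringLeft _ _ _).obj (Functor.pi' fun x => Pi.eval (fun y => (c y : Type u)) (φ x))
  comp {X} _ {Y} _ c e d :=
    { obj := fun F =>
        (Functor.pi' fun x => (Functor.pi' fun y =>
          Pi.eval (fun p : Σ x, Y x => (d p.1 p.2 : Type u)) ⟨x, y⟩) ⋙ F.2 x) ⋙ F.1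
      map := fun α => Functor.whiskerLeft _ α.1 ≫
        Functor.whiskerRight (NatTrans.pi' fun x => Functor.whiskerLeft
          (Functor.pi' fun y => Pi.eval (fun p : Σ x, Y x => (d p.1 p.2 : Type u)) ⟨x, y⟩) (α.2 x)) _
      map_id := fun F => by
        ext z
        exact (Category.id_comp _).trans (F.1.map_id _)
      map_comp := fun {F G K} α β => by
        ext z
        let a : ∀ x, c x := fun x => (F.2 x).obj fun y => z ⟨x, y⟩
        let a' : ∀ x, c x := fun x => (G.2 x).obj fun y => z ⟨x, y⟩
        let a'' : ∀ x, c x := fun x => (K.2 x).obj fun y => z ⟨x, y⟩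
        let f : a ⟶ a' := fun x => (α.2 x).app fun y => z ⟨x, y⟩
        let g : a' ⟶ a'' := fun x => (β.2 x).app fun y => z ⟨x, y⟩
        change (α.1.app a ≫ β.1.app a) ≫ K.1.map (f ≫ g) =
          (α.1.app a ≫ G.1.map f) ≫ β.1.app a' ≫ K.1.map g
        simp }
  relabel_refl _ _ := rfl
  relabel_trans _ _ _ _ := rfl
  comp_relabel_left _ _ _ _ := rfl
  comp_relabel_right _ _ _ _ := rfl
  unit_comp c e := by
    refine CategoryTheory.Functor.hext (fun _ => rfl) (fun F G α => heq_of_eq ?_)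
    refine NatTrans.ext (funext fun z => ?_)
    exact Category.id_comp _
  comp_unit c e := by
    refine CategoryTheory.Functor.hext (fun _ => rfl) (fun F G α => heq_of_eq ?_)
    refine NatTrans.ext (funext fun z => ?_)
    exact (congrArg (α.app z ≫ ·) (G.map_id z)).trans (Category.comp_id _)
  assoc c e d b := by
    refine CategoryTheory.Functor.hext (fun _ => rfl) (fun F G α => heq_of_eq ?_)
    refine NatTrans.ext (funext fun z => ?_)
    exact (Category.assoc _ _ _).trans (congrArg (_ ≫ ·) (G.1.1.map_comp _ _).symm)

/-! ## Trees and the category `Ω` -/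

/-- A finite rooted (non-planar) tree. The edges may be open-ended: every vertex has one outgoing
edge, every edge other than the root is an incoming edge of a unique vertex, and every edge is the
outgoing edge of at most one vertex (the edges which are not the outgoing edge of any vertex are
the leaves). -/
structure DTree where
  Edge : Type
  Vertex : Type
  [finite_edge : Finite Edge]
  [finite_vertex : Finite Vertex]
  root : Edge
  /-- the outgoing edge of a vertex -/
  out : Vertex → Edge
  out_injective : Function.Injective out
  /-- the vertex of which a non-root edge is an incoming edge -/
  target : {e : Edge // e ≠ root} → Vertex
  /-- every edge is connected to the root by a descending path -/
  path_to_root : ∀ e : Edge,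
    Relation.ReflTransGen (fun f g => ∃ h : f ≠ root, out (target ⟨f, h⟩) = g) e root

namespace DTree

attribute [instance] DTree.finite_edge DTree.finite_vertex

/-- `f` is an incoming edge, and `g` the outgoing edge, of one and the same vertex. -/
def Step (T : DTree) (f g : T.Edge) : Prop := ∃ h : f ≠ T.root, T.out (T.target ⟨f, h⟩) = g

theorem Step.rightUnique (T : DTree) : Relator.RightUnique T.Step := by
  rintro a b c ⟨h, rfl⟩ ⟨h', rfl⟩
  rfl

theorem not_step_root (T : DTree) (g : T.Edge) : ¬ T.Step T.root g := fun ⟨h, _⟩ => h rfl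

/-- The edges of a tree are ordered by: `f ≤ e` if the descending path from `f` to the root passes
through `e`. -/
instance (T : DTree) : PartialOrder T.Edge where
  le f e := Relation.ReflTransGen T.Step f e
  le_refl _ := .refl
  le_trans _ _ _ := .trans
  le_antisymm := by
    intro f e h₁ h₂
    have key : ∀ f, Relation.ReflTransGen T.Step f T.root → ∀ e,
        Relation.ReflTransGen T.Step f e → Relation.ReflTransGen T.Step e f → f = e := by
      intro f hf
      induction hf using Relation.ReflTransGen.head_induction_on with
      | refl =>
        intro e h _
        rcases Relation.ReflTransGen.cases_head h with h | ⟨g, hg, _⟩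
        · exact h
        · exact absurd hg (T.not_step_root g)
      | head hfg _ ih =>
        rename_i f g _
        intro e h h'
        rcases Relation.ReflTransGen.cases_head h with h | ⟨g', hg', hge⟩
        · exact h
        · obtain rfl := Step.rightUnique T hfg hg'
          have h1 : g = e := ih e hge (h'.tail hfg)
          subst h1
          exact (ih f h' (.single hfg)).symm
    exact key f (T.path_to_root f) e h₁ h₂

theorem le_root (T : DTree) (e : T.Edge) : e ≤ T.root := T.path_to_root e

theorem Step.le {T : DTree} {f g : T.Edge} (h : T.Step f g) : f ≤ g := Relation.ReflTransGen.single h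

theorem Step.lt {T : DTree} {f g : T.Edge} (h : T.Step f g) : f < g := by
  refine lt_of_le_of_ne h.le ?_
  rintro rfl
  have : ∀ a, Relation.ReflTransGen T.Step a T.root → T.Step a a → False := by
    intro a ha
    induction ha using Relation.ReflTransGen.head_induction_on with
    | refl => exact fun h => T.not_step_root _ h
    | head hab _ ih =>
      intro h
      obtain rfl := Step.rightUnique T hab h
      exact ih h
  exact this f (T.path_to_root f) h

/-- The edges below a given edge form a chain. -/
theorem le_total_of_le {T : DTree} {f a b : T.Edge} (ha : f ≤ a) (hb : f ≤ b) : a ≤ b ∨ b ≤ a :=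
  Relation.ReflTransGen.total_of_right_unique (Step.rightUnique T) ha hb

/-- The incoming edges of a vertex. -/
def Input (T : DTree) (v : T.Vertex) : Type := {i : {e : T.Edge // e ≠ T.root} // T.target i = v}

/-- The underlying edge of an incoming edge. -/
def Input.edge {T : DTree} {v : T.Vertex} (i : T.Input v) : T.Edge := i.1.1

theorem Input.step {T : DTree} {v : T.Vertex} (i : T.Input v) : T.Step i.edge (T.out v) :=
  ⟨i.1.2, congrArg T.out i.2⟩

/-- `T.IsSubtree L e`: the tree `T` has a subtree with set of leaves `L` and with root `e`. Such a
subtree either consists of the edge `e` alone, or it has a bottom vertex `v` with outgoing edge `e`,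
and subtrees are grafted on all the incoming edges of `v`. -/
inductive IsSubtree (T : DTree) : Set T.Edge → T.Edge → Prop
  | edge (e : T.Edge) : IsSubtree T {e} e
  | graft (v : T.Vertex) (L : T.Input v → Set T.Edge) (h : ∀ i, IsSubtree T (L i) i.edge) :
      IsSubtree T (⋃ i, L i) (T.out v)

/-- A set of edges is the set of leaves of a subtree with root `e` if and only if it is an antichain
of edges above `e`, and every leaf of `T` above `e` is above one of them. -/
theorem isSubtree_iff {T : DTree} {L : Set T.Edge} {e : T.Edge} :
    T.IsSubtree L e ↔ (∀ l ∈ L, l ≤ e) ∧ IsAntichain (· ≤ ·) L ∧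
      ∀ f, f ≤ e → f ∉ Set.range T.out → ∃ l ∈ L, f ≤ l := by
  constructor
  · intro h
    induction h with
    | edge e => exact ⟨by simp, by simp, fun f hf _ => ⟨e, rfl, hf⟩⟩
    | graft v L h ih =>
      refine ⟨?_, ?_, ?_⟩
      · intro l hl
        obtain ⟨i, hi⟩ := Set.mem_iUnion.1 hl
        exact ((ih i).1 l hi).trans i.step.le
      · intro a ha b hb hab hle
        obtain ⟨i, hi⟩ := Set.mem_iUnion.1 ha
        obtain ⟨j, hj⟩ := Set.mem_iUnion.1 hb
        have hij : i = j := by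
          have h1 := (ih i).1 a hi
          have h2 := hle.trans ((ih j).1 b hj)
          apply Subtype.ext
          apply Subtype.ext
          change i.edge = j.edge
          by_contra hne
          rcases le_total_of_le h1 h2 with h | h
          · rcases Relation.ReflTransGen.cases_head h with h | ⟨g, hg, hgj⟩
            · exact hne h
            · obtain rfl := Step.rightUnique T i.step hg
              exact absurd (lt_of_lt_of_le j.step.lt hgj) (lt_irrefl _)
          · rcases Relation.ReflTransGen.cases_head h with h | ⟨g, hg, hgj⟩
            · exact hne h.symm
            · obtain rfl := Step.rightUnique T j.step hg
              exact absurd (lt_of_lt_of_le i.step.lt hgj) (lt_irrefl _)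
        subst hij
        exact (ih i).2.1 hi hj hab hle
      · intro f hf hleaf
        rcases Relation.ReflTransGen.cases_tail hf with h | ⟨g, hfg, hroot, hg⟩
        · exact absurd ⟨v, h⟩ hleaf
        · obtain ⟨l, hl, hfl⟩ :=
            (ih ⟨⟨g, hroot⟩, T.out_injective hg⟩).2.2 f hfg hleaf
          exact ⟨l, Set.mem_iUnion.2 ⟨_, hl⟩, hfl⟩
  · induction e using WellFoundedLT.induction generalizing L with
    | ind e ih =>
      rintro ⟨h1, h2, h3⟩
      by_cases he : e ∈ L
      · have : L = {e} := by
          ext l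
          refine ⟨fun hl => ?_, fun hl => by rw [hl]; exact he⟩
          by_contra hne
          exact h2 hl he hne (h1 l hl)
        rw [this]
        exact .edge e
      · by_cases hv : e ∈ Set.range T.out
        · obtain ⟨v, rfl⟩ := hv
          have : L = ⋃ i : T.Input v, {l | l ∈ L ∧ l ≤ i.edge} := by
            ext l
            simp only [Set.mem_iUnion, Set.mem_ofPred_eq]
            refine ⟨fun hl => ?_, fun ⟨_, hl, _⟩ => hl⟩
            rcases Relation.ReflTransGen.cases_tail (h1 l hl) with h | ⟨g, hlg, hroot, hg⟩
            · exact absurd (h ▸ hl) he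
            · exact ⟨⟨⟨g, hroot⟩, T.out_injective hg⟩, hl, hlg⟩
          rw [this]
          refine .graft v _ fun i => ih _ i.step.lt ⟨fun l hl => hl.2, ?_, ?_⟩
          · exact h2.subset fun l hl => hl.1
          · intro f hf hleaf
            obtain ⟨l, hl, hfl⟩ := h3 f (hf.trans i.step.le) hleaf
            refine ⟨l, ⟨hl, ?_⟩, hfl⟩
            rcases le_total_of_le hfl hf with h | h
            · exact h
            · rcases Relation.ReflTransGen.cases_head h with h | ⟨g, hg, hgl⟩
              · exact h ▸ le_rfl
              · obtain rfl := Step.rightUnique T i.step hg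
                exact absurd (le_antisymm hgl (h1 l hl) ▸ hl) he
        · obtain ⟨l, hl, hel⟩ := h3 e le_rfl hv
          exact absurd (le_antisymm (h1 l hl) hel ▸ hl) he

/-- The operad `Ω(T)` has an operation with inputs `c x`, `x ∈ X`, and output `e`, if and only if
the `c x` enumerate, without repetition, the leaves of a subtree with root `e`; there is then exactly
one such operation. -/
def IsOp (T : DTree) {X : Type} (c : X → T.Edge) (e : T.Edge) : Prop :=
  Function.Injective c ∧ T.IsSubtree (Set.range c) e

namespace IsOp

variable {T : DTree} {X : Type} {c : X → T.Edge} {e : T.Edge}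

theorem le (h : T.IsOp c e) (x : X) : c x ≤ e := (isSubtree_iff.1 h.2).1 _ ⟨x, rfl⟩

theorem eq_of_le (h : T.IsOp c e) {x y : X} (hxy : c x ≤ c y) : x = y := by
  by_contra hne
  exact (isSubtree_iff.1 h.2).2.1 ⟨x, rfl⟩ ⟨y, rfl⟩ (fun h' => hne (h.1 h')) hxy

theorem eq_of_le_of_le (h : T.IsOp c e) {x y : X} {f : T.Edge} (hx : f ≤ c x) (hy : f ≤ c y) :
    x = y := by
  rcases le_total_of_le hx hy with h' | h'
  · exact h.eq_of_le h'
  · exact (h.eq_of_le h').symm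

theorem unit (e : T.Edge) : T.IsOp (fun _ : Unit => e) e :=
  ⟨fun _ _ _ => rfl, by simpa using IsSubtree.edge e⟩

theorem relabel {Y : Type} (φ : X ≃ Y) {c : Y → T.Edge} (h : T.IsOp (c ∘ φ) e) : T.IsOp c e := by
  refine ⟨?_, ?_⟩
  · simpa using h.1
  · simpa [Set.range_comp] using h.2

theorem comp (h : T.IsOp c e) {Y : X → Type} {d : ∀ x, Y x → T.Edge}
    (h' : ∀ x, T.IsOp (d x) (c x)) : T.IsOp (fun p : Σ x, Y x => d p.1 p.2) e := by
  have key : ∀ p q : Σ x, Y x, d p.1 p.2 ≤ d q.1 q.2 → p = q := by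
    rintro ⟨x, y⟩ ⟨x', y'⟩ hle
    obtain rfl : x = x' := h.eq_of_le_of_le ((h' x).le y) (hle.trans ((h' x').le y'))
    obtain rfl : y = y' := (h' x).eq_of_le hle
    rfl
  refine ⟨fun p q hpq => key p q hpq.le, isSubtree_iff.2 ⟨?_, ?_, ?_⟩⟩
  · rintro _ ⟨p, rfl⟩
    exact ((h' p.1).le p.2).trans (h.le p.1)
  · rintro _ ⟨p, rfl⟩ _ ⟨q, rfl⟩ hne hle
    exact hne (by rw [key p q hle])
  · intro f hf hleaf
    obtain ⟨_, ⟨x, rfl⟩, hx⟩ := (isSubtree_iff.1 h.2).2.2 f hf hleaf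
    obtain ⟨_, ⟨y, rfl⟩, hy⟩ := (isSubtree_iff.1 (h' x).2).2.2 f hx hleaf
    exact ⟨_, ⟨⟨x, y⟩, rfl⟩, hy⟩

end IsOp

/-- The operad `Ω(T)` of a tree `T`, regarded as a discrete operad enriched in categories. -/
def operad (T : DTree) : CatOperad.{0, 0, 0} where
  Color := T.Edge
  Op c e := Discrete (PLift (T.IsOp c e))
  unit e := ⟨⟨IsOp.unit e⟩⟩
  relabel φ c e := Discrete.functor fun h => ⟨⟨IsOp.relabel φ h.down⟩⟩
  comp c e d :=
    { obj := fun h => ⟨⟨h.1.as.down.comp fun x => (h.2 x).as.down⟩⟩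
      map := fun _ => eqToHom rfl }
  relabel_refl _ _ := functor_ext_of_thin fun _ => rfl
  relabel_trans _ _ _ _ := functor_ext_of_thin fun _ => rfl
  comp_relabel_left _ _ _ _ := functor_ext_of_thin fun _ => rfl
  comp_relabel_right _ _ _ _ := functor_ext_of_thin fun _ => rfl
  unit_comp _ _ := functor_ext_of_thin fun _ => rfl
  comp_unit _ _ := functor_ext_of_thin fun _ => rfl
  assoc _ _ _ _ := functor_ext_of_thin fun _ => rfl

/-- The category `Ω` of trees: the morphisms `R ⟶ T` are the maps of operads `Ω(R) → Ω(T)`. -/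
instance : Category DTree where
  Hom R T := CatOperad.Hom R.operad T.operad
  id T := CatOperad.Hom.id T.operad
  comp f g := CatOperad.Hom.comp f g

/-- The map on edges underlying a morphism of trees. -/
def edgeMap {R T : DTree} (δ : R ⟶ T) : R.Edge → T.Edge := CatOperad.Hom.color δ

theorem IsOp.map {R T : DTree} (δ : R ⟶ T) {X : Type} [Finite X] {c : X → R.Edge} {e : R.Edge}
    (h : R.IsOp c e) : T.IsOp (edgeMap δ ∘ c) (edgeMap δ e) :=
  let ⟨h'⟩ := CatOperad.Hom.nonempty_op δ (c := c) (e := e) ⟨⟨⟨h⟩⟩⟩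
  (show Discrete (PLift (T.IsOp (edgeMap δ ∘ c) (edgeMap δ e))) from h').as.down

/-- Every antichain of edges above `e` extends to the set of leaves of a subtree with root `e`. -/
theorem exists_isOp {T : DTree} {e : T.Edge} {A : Set T.Edge} (hA : IsAntichain (· ≤ ·) A)
    (hAe : ∀ a ∈ A, a ≤ e) : ∃ L : Set T.Edge, A ⊆ L ∧ T.IsOp (fun l : L => (l : T.Edge)) e := by
  refine ⟨A ∪ {f | f ≤ e ∧ f ∉ Set.range T.out ∧ ∀ a ∈ A, ¬ f ≤ a}, Set.subset_union_left,
    Subtype.val_injective, ?_⟩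
  have min : ∀ f g : T.Edge, f ∉ Set.range T.out → g ≤ f → g = f := by
    intro f g hf h
    rcases Relation.ReflTransGen.cases_tail h with h | ⟨k, _, hr, hk⟩
    · exact h.symm
    · exact absurd ⟨_, hk⟩ hf
  rw [Subtype.range_coe]
  refine isSubtree_iff.2 ⟨?_, ?_, ?_⟩
  · rintro l (hl | hl)
    · exact hAe l hl
    · exact hl.1
  · rintro a (ha | ha) b (hb | hb) hab hle
    · exact hA ha hb hab hle
    · exact hab (min b a hb.2.1 hle)
    · exact ha.2.2 b hb hle
    · exact hab (min b a hb.2.1 hle)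
  · intro f hf hleaf
    by_cases h : ∃ a ∈ A, f ≤ a
    · obtain ⟨a, ha, hfa⟩ := h
      exact ⟨a, Or.inl ha, hfa⟩
    · exact ⟨f, Or.inr ⟨hf, hleaf, fun a ha hfa => h ⟨a, ha, hfa⟩⟩, le_rfl⟩

/-- Maps in `Ω` are monotone on edges. -/
theorem edgeMap_mono {R T : DTree} (δ : R ⟶ T) {a b : R.Edge} (h : a ≤ b) :
    edgeMap δ a ≤ edgeMap δ b := by
  obtain ⟨L, hL, hop⟩ := exists_isOp (A := {a}) (e := b) (by simp) (by simpa using h)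
  exact (hop.map δ).le ⟨a, hL rfl⟩

/-- Maps in `Ω` preserve incomparability of edges. -/
theorem le_or_le_of_edgeMap_le {R T : DTree} (δ : R ⟶ T) {a b : R.Edge}
    (h : edgeMap δ a ≤ edgeMap δ b) : a ≤ b ∨ b ≤ a := by
  by_contra hne
  push Not at hne
  obtain ⟨L, hL, hop⟩ := exists_isOp (A := {a, b}) (e := R.root)
    (by
      rintro x (rfl | rfl) y (rfl | rfl) hxy hle
      · exact hxy rfl
      · exact hne.1 hle
      · exact hne.2 hle
      · exact hxy rfl) (fun x _ => R.le_root x)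
  have := (hop.map δ).eq_of_le (x := ⟨a, hL (by simp)⟩) (y := ⟨b, hL (by simp)⟩) h
  exact hne.1 (by rw [Subtype.mk.inj this])

/-! ## The `W`-construction -/

/-- The inner edges of the subtree of `T` with leaves `c x`, `x ∈ X`, and root `e`: the edges
strictly above `e` which are not above (or equal to) any of the leaves of the subtree. -/
def inner (T : DTree) {X : Type} (c : X → T.Edge) (e : T.Edge) : Set T.Edge :=
  {f | f < e ∧ ∀ x, ¬ f ≤ c x}

/-- The interval `H`: the category with two objects `0` (that is, `false`) and `1` (that is, `true`)
and exactly one morphism, an isomorphism, from any object to any object. -/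
abbrev H : Type := Codiscrete Bool

instance {P : Prop} {I : Type} : Quiver.IsThin (Discrete (PLift P) × (I → H)) := fun _ _ =>
  ⟨fun _ _ => Prod.ext (Subsingleton.elim _ _) (funext fun _ => rfl)⟩

/-- The functor to `H ^ I` (or to the empty category, when `P` is false) given by a function on
objects: between any two objects of the target there is exactly one morphism. -/
def toCube {A : Type*} [Category A] {P : Prop} {I : Type} (F : A → Discrete (PLift P) × (I → H)) :
    A ⥤ Discrete (PLift P) × (I → H) where
  obj := F
  map {a b} _ := ⟨eqToHom (Subsingleton.elim (F a).1 (F b).1), fun _ => (Codiscrete.iso _ _).hom⟩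
  map_id _ := Subsingleton.elim _ _
  map_comp _ _ := Subsingleton.elim _ _

open Classical in
/-- The composition of the `W`-construction on lengths of inner edges: an inner edge of the
composite subtree is an inner edge of one of the pieces, and keeps its length, or it is one of the
edges along which the pieces are grafted, and gets length `1`. -/
noncomputable def compLength (T : DTree) {X : Type} {Y : X → Type} (c : X → T.Edge) (e : T.Edge)
    (d : ∀ x, Y x → T.Edge) (ℓ : T.inner c e → Bool) (ℓ' : ∀ x, T.inner (d x) (c x) → Bool)
    (f : T.inner (fun p : Σ x, Y x => d p.1 p.2) e) : Bool :=
  if h : f.1 ∈ T.inner c e then ℓ ⟨f.1, h⟩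
  else if h : ∃ x, f.1 ∈ T.inner (d x) (c x) then ℓ' h.choose ⟨f.1, h.choose_spec⟩
  else true

theorem compLength_iff {T : DTree} {X : Type} {Y : X → Type} {c : X → T.Edge} {e : T.Edge}
    (hc : T.IsOp c e) {d : ∀ x, Y x → T.Edge} (ℓ : T.inner c e → Bool)
    (ℓ' : ∀ x, T.inner (d x) (c x) → Bool) (f : T.inner (fun p : Σ x, Y x => d p.1 p.2) e) :
    T.compLength c e d ℓ ℓ' f = true ↔
      (∀ h : f.1 ∈ T.inner c e, ℓ ⟨f.1, h⟩ = true) ∧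
        ∀ x, ∀ h : f.1 ∈ T.inner (d x) (c x), ℓ' x ⟨f.1, h⟩ = true := by
  unfold compLength
  split_ifs with h h'
  · exact ⟨fun H => ⟨fun _ => H, fun x hx => absurd hx.1.le (h.2 x)⟩, fun H => H.1 h⟩
  · refine ⟨fun H => ⟨fun h1 => absurd h1 h, fun x hx => ?_⟩, fun H => H.2 _ _⟩
    obtain rfl : h'.choose = x := hc.eq_of_le_of_le h'.choose_spec.1.le hx.1.le
    exact H
  · exact ⟨fun _ => ⟨fun h1 => absurd h1 h, fun x hx => absurd ⟨x, hx⟩ h'⟩, fun _ => rfl⟩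

section

variable {T : DTree} {X X' : Type} {Y Y' : X → Type} {c : X → T.Edge} {e : T.Edge}

theorem compLength_relabel_left (φ : X' ≃ X) (hc : T.IsOp (c ∘ φ) e) (d : ∀ x, Y x → T.Edge)
    (ℓ : T.inner (c ∘ φ) e → Bool) (ℓ' : ∀ x, T.inner (d x) (c x) → Bool)
    (f : T.inner (fun p : Σ x, Y x => d p.1 p.2) e) :
    T.compLength c e d (fun f => ℓ ⟨f.1, f.2.1, fun x => f.2.2 (φ x)⟩) ℓ' f =
      T.compLength (c ∘ φ) e (fun x => d (φ x)) ℓ (fun x => ℓ' (φ x))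
        ⟨f.1, f.2.1, fun p => f.2.2 ⟨φ p.1, p.2⟩⟩ := by
  refine Bool.eq_iff_iff.2 ?_
  rw [compLength_iff (hc.relabel φ), compLength_iff hc]
  refine and_congr ⟨fun H h => H ⟨h.1, fun x => ?_⟩, fun H h => H _⟩
    ⟨fun H x h => H (φ x) h, fun H x => ?_⟩
  · simpa using h.2 (φ.symm x)
  · obtain ⟨x, rfl⟩ := φ.surjective x
    exact H x

theorem compLength_relabel_right (ψ : ∀ x, Y x ≃ Y' x) (hc : T.IsOp c e) (d : ∀ x, Y' x → T.Edge)
    (ℓ : T.inner c e → Bool) (ℓ' : ∀ x, T.inner (d x ∘ ψ x) (c x) → Bool)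
    (f : T.inner (fun p : Σ x, Y' x => d p.1 p.2) e) :
    T.compLength c e d ℓ (fun x f => ℓ' x ⟨f.1, f.2.1, fun y => f.2.2 (ψ x y)⟩) f =
      T.compLength c e (fun x => d x ∘ ψ x) ℓ ℓ'
        ⟨f.1, f.2.1, fun p => f.2.2 ⟨p.1, ψ p.1 p.2⟩⟩ := by
  refine Bool.eq_iff_iff.2 ?_
  rw [compLength_iff hc, compLength_iff hc]
  refine and_congr Iff.rfl ⟨fun H x h => H x ⟨h.1, fun y => ?_⟩, fun H x h => H x _⟩
  simpa using h.2 ((ψ x).symm y)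

theorem compLength_unit_left (ℓ : T.inner (fun _ : Unit => e) e → Bool)
    (ℓ' : Unit → T.inner c e → Bool) (f : T.inner c e) :
    T.compLength (fun _ : Unit => e) e (fun _ => c) ℓ ℓ' ⟨f.1, f.2.1, fun p => f.2.2 p.2⟩ =
      ℓ' () f := by
  refine Bool.eq_iff_iff.2 ?_
  rw [compLength_iff (IsOp.unit e)]
  exact ⟨fun H => H.2 () f.2, fun H => ⟨fun h => absurd h.1.le (h.2 ()), fun _ _ => H⟩⟩

theorem compLength_unit_right (hc : T.IsOp c e) (ℓ : T.inner c e → Bool)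
    (ℓ' : ∀ x, T.inner (fun _ : Unit => c x) (c x) → Bool) (f : T.inner c e) :
    T.compLength c e (fun x (_ : Unit) => c x) ℓ ℓ' ⟨f.1, f.2.1, fun p => f.2.2 p.1⟩ = ℓ f := by
  refine Bool.eq_iff_iff.2 ?_
  rw [compLength_iff hc]
  exact ⟨fun H => H.1 f.2, fun H => ⟨fun _ => H, fun x h => absurd h.1.le (h.2 ())⟩⟩

theorem compLength_assoc {Z : ∀ x, Y x → Type} (hc : T.IsOp c e) {d : ∀ x, Y x → T.Edge}
    (hd : ∀ x, T.IsOp (d x) (c x)) (b : ∀ x y, Z x y → T.Edge) (ℓ : T.inner c e → Bool)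
    (ℓ' : ∀ x, T.inner (d x) (c x) → Bool) (ℓ'' : ∀ p : Σ x, Y x,
      T.inner (b p.1 p.2) (d p.1 p.2) → Bool)
    (f : T.inner (fun q : Σ x, Σ y, Z x y => b q.1 q.2.1 q.2.2) e) :
    T.compLength (fun p : Σ x, Y x => d p.1 p.2) e (fun p => b p.1 p.2) (T.compLength c e d ℓ ℓ') ℓ''
        ⟨f.1, f.2.1, fun p => f.2.2 ⟨p.1.1, p.1.2, p.2⟩⟩ =
      T.compLength c e (fun x (q : Σ y, Z x y) => b x q.1 q.2) ℓ
        (fun x => T.compLength (d x) (c x) (b x) (ℓ' x) (fun y => ℓ'' ⟨x, y⟩)) f := by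
  refine Bool.eq_iff_iff.2 ?_
  rw [compLength_iff (hc.comp hd), compLength_iff hc]
  constructor
  · rintro ⟨h1, h2⟩
    refine ⟨fun h => ?_, fun x h => (compLength_iff (hd x) _ _ _).2 ⟨fun h' => ?_, fun y h' =>
      h2 ⟨x, y⟩ h'⟩⟩
    · have hf : f.1 ∈ T.inner (fun p : Σ x, Y x => d p.1 p.2) e :=
        ⟨f.2.1, fun p hp => h.2 p.1 (hp.trans ((hd p.1).le p.2))⟩
      exact ((compLength_iff hc _ _ _).1 (h1 hf)).1 h
    · have hf : f.1 ∈ T.inner (fun p : Σ x, Y x => d p.1 p.2) e := by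
        refine ⟨f.2.1, fun ⟨x', y⟩ hp => ?_⟩
        obtain rfl : x = x' := hc.eq_of_le_of_le h'.1.le (hp.trans ((hd x').le y))
        exact h'.2 y hp
      exact ((compLength_iff hc _ _ _).1 (h1 hf)).2 x h'
  · rintro ⟨h1, h2⟩
    refine ⟨fun h => (compLength_iff hc _ _ _).2 ⟨fun h' => h1 h', fun x h' => ?_⟩,
      fun ⟨x, y⟩ h' => ?_⟩
    · exact ((compLength_iff (hd x) _ _ _).1
        (h2 x ⟨h'.1, fun q => f.2.2 ⟨x, q.1, q.2⟩⟩)).1 h'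
    · exact ((compLength_iff (hd x) _ _ _).1
        (h2 x ⟨h'.1.trans_le ((hd x).le y), fun q => f.2.2 ⟨x, q.1, q.2⟩⟩)).2 y h'

end

/-- The `W`-construction `W(Ω(T))`: the category of operations with inputs `c x`, `x ∈ X`, and output
`e` is the power of `H` indexed by the inner edges of the subtree with leaves `c x` and root `e` if
there is such a subtree, and it is empty otherwise. -/
noncomputable def W (T : DTree) : CatOperad.{0, 0, 0} where
  Color := T.Edge
  Op c e := Discrete (PLift (T.IsOp c e)) × (T.inner c e → H)
  unit e := ⟨⟨⟨IsOp.unit e⟩⟩, fun f => absurd f.2.1.le (f.2.2 ())⟩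
  relabel φ _ _ := toCube fun a =>
    ⟨⟨⟨a.1.as.down.relabel φ⟩⟩, fun f => a.2 ⟨f.1, f.2.1, fun x => f.2.2 (φ x)⟩⟩
  comp c e d := toCube fun a =>
    ⟨⟨⟨a.1.1.as.down.comp fun x => (a.2 x).1.as.down⟩⟩, fun f =>
      ⟨T.compLength c e d (fun f => (a.1.2 f).as) (fun x f => ((a.2 x).2 f).as) f⟩⟩
  relabel_refl _ _ := functor_ext_of_thin fun _ => rfl
  relabel_trans _ _ _ _ := functor_ext_of_thin fun _ => rfl
  comp_relabel_left φ _ _ d := functor_ext_of_thin fun a =>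
    Prod.ext rfl (funext fun f => congrArg Codiscrete.mk
      (compLength_relabel_left φ a.1.1.as.down d (fun f => (a.1.2 f).as)
        (fun x f => ((a.2 x).2 f).as) f))
  comp_relabel_right ψ _ _ d := functor_ext_of_thin fun a =>
    Prod.ext rfl (funext fun f => congrArg Codiscrete.mk
      (compLength_relabel_right ψ a.1.1.as.down d (fun f => (a.1.2 f).as)
        (fun x f => ((a.2 x).2 f).as) f))
  unit_comp _ _ := functor_ext_of_thin fun a =>
    Prod.ext rfl (funext fun f => congrArg Codiscrete.mk
      (compLength_unit_left _ (fun _ f => (a.2 f).as) f))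
  comp_unit _ _ := functor_ext_of_thin fun a =>
    Prod.ext rfl (funext fun f => congrArg Codiscrete.mk
      (compLength_unit_right a.1.as.down (fun f => (a.2 f).as) _ f))
  assoc _ _ _ b := functor_ext_of_thin fun a =>
    Prod.ext rfl (funext fun f => congrArg Codiscrete.mk
      (compLength_assoc a.1.1.1.as.down (fun x => (a.1.2 x).1.as.down) b (fun f => (a.1.1.2 f).as)
        (fun x f => ((a.1.2 x).2 f).as) (fun p f => ((a.2 p).2 f).as) f))

open Classical in
/-- The map on lengths of inner edges induced by a map of trees `δ : R ⟶ T`: the length of an inner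
edge `g` is the maximum (that is, the monoid structure `∨` of `H`) of the lengths of the inner edges
which `δ` maps to `g`; in particular it is the neutral element `0` if there are none. The lengths of
the inner edges which are mapped to an outer edge are forgotten. -/
noncomputable def mapLength {R T : DTree} (δ : R ⟶ T) {X : Type} (c : X → R.Edge) (e : R.Edge)
    (ℓ : R.inner c e → Bool) (g : T.inner (edgeMap δ ∘ c) (edgeMap δ e)) : Bool :=
  decide (∃ f : R.inner c e, edgeMap δ f = g ∧ ℓ f = true)

theorem mapLength_iff {R T : DTree} {δ : R ⟶ T} {X : Type} {c : X → R.Edge} {e : R.Edge}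
    {ℓ : R.inner c e → Bool} {g : T.inner (edgeMap δ ∘ c) (edgeMap δ e)} :
    mapLength δ c e ℓ g = true ↔ ∃ f : R.inner c e, edgeMap δ f = g ∧ ℓ f = true := by
  classical
  unfold mapLength
  exact decide_eq_true_iff

theorem mapLength_comp {R T : DTree} (δ : R ⟶ T) {X : Type} [Finite X] {Y : X → Type}
    [∀ x, Finite (Y x)] {c : X → R.Edge} {e : R.Edge} (hc : R.IsOp c e) {d : ∀ x, Y x → R.Edge}
    (hd : ∀ x, R.IsOp (d x) (c x)) (ℓ : R.inner c e → Bool)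
    (ℓ' : ∀ x, R.inner (d x) (c x) → Bool)
    (g : T.inner (fun p : Σ x, Y x => edgeMap δ (d p.1 p.2)) (edgeMap δ e)) :
    mapLength δ (fun p : Σ x, Y x => d p.1 p.2) e (R.compLength c e d ℓ ℓ') g =
      T.compLength (edgeMap δ ∘ c) (edgeMap δ e) (fun x => edgeMap δ ∘ d x) (mapLength δ c e ℓ)
        (fun x => mapLength δ (d x) (c x) (ℓ' x)) g := by
  refine Bool.eq_iff_iff.2 (mapLength_iff.trans (Iff.trans ?_ (compLength_iff (hc.map δ) _ _ _).symm))
  simp only [mapLength_iff]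
  constructor
  · rintro ⟨⟨f, hf⟩, hfg, h⟩
    rw [compLength_iff hc] at h
    change edgeMap δ f = g.1 at hfg
    refine ⟨fun hg => ?_, fun x hg => ?_⟩
    · have hf' : f ∈ R.inner c e :=
        ⟨hf.1, fun x hx => hg.2 x (hfg ▸ edgeMap_mono δ hx)⟩
      exact ⟨⟨f, hf'⟩, hfg, h.1 hf'⟩
    · have hlt : edgeMap δ f < edgeMap δ (c x) := hfg ▸ hg.1
      have hf' : f ∈ R.inner (d x) (c x) := by
        refine ⟨?_, fun y => hf.2 ⟨x, y⟩⟩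
        rcases le_or_le_of_edgeMap_le δ hlt.le with h' | h'
        · exact lt_of_le_of_ne h' fun h'' => by simp [h''] at hlt
        · exact absurd hlt (edgeMap_mono δ h').not_gt
      exact ⟨⟨f, hf'⟩, hfg, h.2 x hf'⟩
  · rintro ⟨h1, h2⟩
    by_cases hg : g.1 ∈ T.inner (edgeMap δ ∘ c) (edgeMap δ e)
    · obtain ⟨f, hfg, hf⟩ := h1 hg
      refine ⟨⟨f, f.2.1, fun p hp => f.2.2 p.1 (hp.trans ((hd p.1).le p.2))⟩, hfg, ?_⟩
      rw [compLength_iff hc]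
      exact ⟨fun _ => hf, fun x hx => absurd hx.1.le (f.2.2 x)⟩
    · obtain ⟨x, hx⟩ : ∃ x, g.1 ≤ edgeMap δ (c x) := by
        by_contra hne
        push Not at hne
        exact hg ⟨g.2.1, hne⟩
      rcases hx.lt_or_eq with hx | hx
      · obtain ⟨f, hfg, hf⟩ := h2 x ⟨hx, fun y => g.2.2 ⟨x, y⟩⟩
        refine ⟨⟨f, f.2.1.trans_le (hc.le x), fun ⟨x', y⟩ hp => ?_⟩, hfg, ?_⟩
        · obtain rfl : x = x' := hc.eq_of_le_of_le f.2.1.le (hp.trans ((hd x').le y))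
          exact f.2.2 y hp
        · rw [compLength_iff hc]
          refine ⟨fun h => absurd f.2.1.le (h.2 x), fun x' h => ?_⟩
          obtain rfl : x = x' := hc.eq_of_le_of_le f.2.1.le h.1.le
          exact hf
      · refine ⟨⟨c x, lt_of_le_of_ne (hc.le x) ?_, fun p hp => ?_⟩, hx.symm, ?_⟩
        · intro h
          have := g.2.1
          rw [hx, h] at this
          exact lt_irrefl _ this
        · refine g.2.2 p ?_
          rw [hx]
          exact edgeMap_mono δ hp
        · rw [compLength_iff hc]
          refine ⟨fun h => absurd le_rfl (h.2 x), fun x' h => ?_⟩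
          obtain rfl : x = x' := hc.eq_of_le h.1.le
          exact absurd h.1 (lt_irrefl _)

theorem mapLength_relabel {R T : DTree} (δ : R ⟶ T) {X Y : Type} (φ : X ≃ Y) {c : Y → R.Edge}
    {e : R.Edge} (ℓ : R.inner (c ∘ φ) e → Bool) (g : T.inner (edgeMap δ ∘ c) (edgeMap δ e)) :
    mapLength δ c e (fun f => ℓ ⟨f.1, f.2.1, fun x => f.2.2 (φ x)⟩) g =
      mapLength δ (c ∘ φ) e ℓ ⟨g.1, g.2.1, fun x => g.2.2 (φ x)⟩ := by
  refine Bool.eq_iff_iff.2 (mapLength_iff.trans (Iff.trans ?_ mapLength_iff.symm))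
  exact ⟨fun ⟨f, hf⟩ => ⟨⟨f.1, f.2.1, fun x => f.2.2 (φ x)⟩, hf⟩,
    fun ⟨f, hf⟩ => ⟨⟨f.1, f.2.1, fun y => by simpa using f.2.2 (φ.symm y)⟩, hf⟩⟩

theorem mapLength_id {T : DTree} {X : Type} {c : X → T.Edge} {e : T.Edge}
    (ℓ : T.inner c e → Bool) (g : T.inner c e) : mapLength (𝟙 T) c e ℓ g = ℓ g := by
  refine Bool.eq_iff_iff.2 (mapLength_iff.trans ?_)
  constructor
  · rintro ⟨f, hfg, hf⟩
    obtain rfl : f = g := Subtype.ext hfg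
    exact hf
  · exact fun h => ⟨g, rfl, h⟩

theorem mapLength_mapLength {R S T : DTree} (δ : R ⟶ S) (ε : S ⟶ T) {X : Type} {c : X → R.Edge}
    {e : R.Edge} (ℓ : R.inner c e → Bool)
    (g : T.inner (edgeMap (δ ≫ ε) ∘ c) (edgeMap (δ ≫ ε) e)) :
    mapLength (δ ≫ ε) c e ℓ g =
      mapLength ε (edgeMap δ ∘ c) (edgeMap δ e) (mapLength δ c e ℓ) g := by
  refine Bool.eq_iff_iff.2 (mapLength_iff.trans (Iff.trans ?_ mapLength_iff.symm))
  simp only [mapLength_iff]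
  constructor
  · rintro ⟨f, hfg, hf⟩
    change edgeMap ε (edgeMap δ f) = g.1 at hfg
    refine ⟨⟨edgeMap δ f, lt_of_le_of_ne (edgeMap_mono δ f.2.1.le) fun h => ?_, fun x hx => ?_⟩,
      hfg, f, rfl, hf⟩
    · have h' : g.1 < edgeMap ε (edgeMap δ e) := g.2.1
      rw [← hfg, h] at h'
      exact lt_irrefl _ h'
    · refine g.2.2 x ?_
      rw [← hfg]
      exact edgeMap_mono ε hx
  · rintro ⟨f', hfg, f, hff, hf⟩
    refine ⟨f, ?_, hf⟩
    rw [← hfg, ← hff]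
    rfl

/-- The map of operads `W(Ω(R)) → W(Ω(T))` induced by a map of trees `R ⟶ T`. -/
noncomputable def W.map {R T : DTree} (δ : R ⟶ T) : CatOperad.Hom R.W T.W where
  color := edgeMap δ
  app c e := toCube fun a =>
    ⟨⟨⟨a.1.as.down.map δ⟩⟩, fun g => ⟨mapLength δ c e (fun f => (a.2 f).as) g⟩⟩
  app_unit _ := Prod.ext rfl (funext fun f => absurd f.2.1.le (f.2.2 ()))
  app_relabel φ c e := functor_ext_of_thin
    (B := Discrete (PLift (T.IsOp (edgeMap δ ∘ c) (edgeMap δ e))) ×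
      (T.inner (edgeMap δ ∘ c) (edgeMap δ e) → H)) fun a =>
    Prod.ext rfl (funext fun g => congrArg Codiscrete.mk
      (mapLength_relabel δ φ (fun f => (a.2 f).as) g))
  app_comp _ e d := functor_ext_of_thin
    (B := Discrete (PLift (T.IsOp (fun p : Σ _, _ => edgeMap δ (d p.1 p.2)) (edgeMap δ e))) ×
      (T.inner (fun p : Σ _, _ => edgeMap δ (d p.1 p.2)) (edgeMap δ e) → H)) fun a =>
    Prod.ext rfl (funext fun g => congrArg Codiscrete.mk
      (mapLength_comp δ a.1.1.as.down (fun x => (a.2 x).1.as.down) (fun f => (a.1.2 f).as)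
        (fun x f => ((a.2 x).2 f).as) g))

theorem W.map_id (T : DTree) : W.map (𝟙 T) = CatOperad.Hom.id T.W :=
  CatOperad.Hom.ext' rfl fun c e => heq_of_eq (functor_ext_of_thin
    (B := Discrete (PLift (T.IsOp c e)) × (T.inner c e → H)) fun a =>
      Prod.ext rfl (funext fun g => congrArg Codiscrete.mk (mapLength_id (fun f => (a.2 f).as) g)))

theorem W.map_comp {R S T : DTree} (δ : R ⟶ S) (ε : S ⟶ T) :
    W.map (δ ≫ ε) = (W.map δ).comp (W.map ε) :=
  CatOperad.Hom.ext' rfl fun c e => heq_of_eq (functor_ext_of_thin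
    (B := Discrete (PLift (T.IsOp (edgeMap (δ ≫ ε) ∘ c) (edgeMap (δ ≫ ε) e))) ×
      (T.inner (edgeMap (δ ≫ ε) ∘ c) (edgeMap (δ ≫ ε) e) → H)) fun a =>
      Prod.ext rfl (funext fun g => congrArg Codiscrete.mk
        (mapLength_mapLength δ ε (fun f => (a.2 f).as) g)))

end DTree

/-! ## Dendroidal sets -/

/-- The homotopy coherent dendroidal nerve of an operad `P` enriched in categories: the dendroidal
set (that is, presheaf on `Ω`) with `hcNd(P)_T = Hom(W(Ω(T)), P)`. -/
noncomputable def hcNd (P : CatOperad.{u, w, v}) : DTreeᵒᵖ ⥤ Type (max 1 u w v) where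
  obj T := CatOperad.Hom T.unop.W P
  map δ := ↾fun t => (DTree.W.map δ.unop).comp t
  map_id T := by
    ext t
    exact congrArg (CatOperad.Hom.comp · t) (DTree.W.map_id T.unop)
  map_comp δ ε := by
    ext t
    exact congrArg (CatOperad.Hom.comp · t) (DTree.W.map_comp ε.unop δ.unop)

/-- The dendroidal set `wCat¹ = hcNd(Ctg)` of weak `1`-categories. -/
noncomputable def wCatOne : DTreeᵒᵖ ⥤ Type (max (u + 1) (v + 1)) := hcNd Ctg.{u, v}

/-- The full subcategory of `Ω` consisting of the trees with at most `k` vertices. -/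
abbrev DTree.Truncated (k : ℕ) : Type 1 :=
  ObjectProperty.FullSubcategory fun T : DTree => Nat.card T.Vertex ≤ k

/-- The inclusion `i_k` of the trees with at most `k` vertices. -/
abbrev DTree.truncatedInclusion (k : ℕ) : DTree.Truncated k ⥤ DTree := ObjectProperty.ι _

section Skeleton

variable [UnivLE.{1, w}]

/-- The `k`-skeleton functor `Sk_k = (i_k)_! (i_k)^*` of dendroidal sets: the restriction to the trees
with at most `k` vertices, followed by the left adjoint (left Kan extension) of the restriction. -/
noncomputable def skeleton (k : ℕ) : (DTreeᵒᵖ ⥤ Type w) ⥤ (DTreeᵒᵖ ⥤ Type w) :=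
  (Functor.whiskeringLeft _ _ _).obj (DTree.truncatedInclusion k).op ⋙
    (DTree.truncatedInclusion k).op.lan

/-- The canonical map `Sk_k(X) ⟶ X`. -/
noncomputable def skeletonι (k : ℕ) : skeleton.{w} k ⟶ 𝟭 (DTreeᵒᵖ ⥤ Type w) :=
  ((DTree.truncatedInclusion k).op.lanAdjunction (Type w)).counit

end Skeleton

/-- The `k`-skeleton of a dendrex `t` of shape `T` of a dendroidal set `X`: the composite
`Sk_k(Ω[T]) ⟶ Ω[T] ⟶ X`, whose second map corresponds to `t` under the Yoneda lemma. -/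
noncomputable def Sk (k : ℕ) {X : DTreeᵒᵖ ⥤ Type (max w 1)} {T : DTree} (t : X.obj (Opposite.op T)) :
    (skeleton k).obj (uliftYoneda.{w}.obj T) ⟶ X :=
  (skeletonι k).app (uliftYoneda.{w}.obj T) ≫ uliftYonedaEquiv.symm t

-- Recovering restrictions from the skeleton

universe u' v' w'

/-! A dendrex is a map out of `W(Ω(T))`, and such a map is determined by its restrictions along
morphisms into `T` from trees with two vertices; nothing about the target operad is needed beyond
its axioms. By adjunction, equality of 2-skeleta says that all these restrictions agree
(`map_eq_of_Sk_eq`), so the content lies in `W.hom_ext_of_twoLevel`.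

The operations of a given signature form a cube `H ^ I`, with `I` the set of inner edges of the
subtree. There is one arrow between any two vertices of the cube and it is invertible, so it is
enough to compare the two maps on the arrows from the origin `0` to an arbitrary `ℓ`. If `ℓ` is not
`0`, choose `g` with `ℓ g = 1` and go through the indicator of `g`.

The arrow from `0` to the indicator of `g` comes from a tree with two vertices: contract every inner
edge other than `g`, and send the two vertices to the operations below and above `g`
(`W.map_twoLevelHom_op`). On the rest of the path `g` has length `1` at both ends, so both ends are
composites along `g`, and so is the arrow between them (`W.op_eq_relabel_comp`,
`W.agreeBetween_of_cut`). The pieces have fewer inner edges, and induction on the number of inner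
edges concludes. -/

theorem CategoryTheory.Adjunction.map_eq_of_counit_comp_eq {C D : Type*} [Category C] [Category D]
    {F : C ⥤ D} {G : D ⥤ C} (adj : F ⊣ G) {Y Z : D} {f g : Y ⟶ Z}
    (h : adj.counit.app Y ≫ f = adj.counit.app Y ≫ g) : G.map f = G.map g := by
  -- By naturality of the counit and a triangle identity, `G.map f` depends only on the transpose of
  -- `counit ≫ f`.
  have key : ∀ f : Y ⟶ Z, G.map f = adj.unit.app (G.obj Y) ≫ G.map (adj.counit.app Y ≫ f) := by
    simp
  rw [key f, key g, h]

/-- Dendrices with the same `k`-skeleton have the same restrictions to trees with at most `k`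
vertices. -/
theorem map_eq_of_Sk_eq {k : ℕ} {X : DTreeᵒᵖ ⥤ Type (max w 1)} {T : DTree}
    {t s : X.obj (Opposite.op T)} (h : Sk.{w} k t = Sk.{w} k s) {R : DTree}
    (hR : Nat.card R.Vertex ≤ k) (δ : R ⟶ T) : X.map δ.op t = X.map δ.op s := by
  have h1 := Adjunction.map_eq_of_counit_comp_eq
    ((DTree.truncatedInclusion k).op.lanAdjunction (Type (max w 1))) h
  -- The Yoneda maps of `t` and `s` now agree on truncated trees; they are evaluated at the dendrex
  -- `δ` of the representable.
  exact congrArg (fun α => α.app (Opposite.op ⟨R, hR⟩) ⟨δ⟩) h1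

/-! ### Morphisms of trees from their values on vertices -/

namespace DTree

/-- Injectivity of `c ∘ ψ` already makes `ψ` injective, so index sets can be changed without
constructing an inverse bijection. -/
theorem IsOp.of_surjective {T : DTree} {X Y : Type} {c : Y → T.Edge} {e : T.Edge} (ψ : X → Y)
    (hψ : Function.Surjective ψ) (h : T.IsOp (c ∘ ψ) e) : T.IsOp c e := by
  refine ⟨fun a b hab => ?_, by simpa [hψ.range_comp] using h.2⟩
  obtain ⟨x, rfl⟩ := hψ a
  obtain ⟨y, rfl⟩ := hψ b
  rw [h.1 hab]

theorem IsOp.comp_equiv {T : DTree} {X Y : Type} {c : Y → T.Edge} {e : T.Edge} (h : T.IsOp c e)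
    (ψ : X ≃ Y) : T.IsOp (c ∘ ψ) e :=
  ⟨h.1.comp ψ.injective, by simpa [Set.range_comp] using h.2⟩

section Hom

variable {R T : DTree}

/-- This is the freeness of `Ω(R)` on its vertices: a subtree is an iterated grafting of vertices,
and operations of `Ω(T)` are closed under units and composition. -/
theorem IsSubtree.isOp_map (φ : R.Edge → T.Edge)
    (hφ : ∀ v : R.Vertex, T.IsOp (fun i : R.Input v => φ i.edge) (φ (R.out v)))
    {L : Set R.Edge} {e : R.Edge} (h : R.IsSubtree L e) : T.IsOp (fun l : L => φ l) (φ e) := by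
  induction h with
  | edge e =>
    exact IsOp.of_surjective (fun _ : Unit => ⟨e, rfl⟩) (fun ⟨l, hl⟩ => ⟨(), Subtype.ext hl.symm⟩)
      (IsOp.unit (φ e))
  | graft v L h ih =>
    refine IsOp.of_surjective
      (fun p : Σ i, L i => (⟨p.2.1, Set.mem_iUnion.2 ⟨p.1, p.2.2⟩⟩ : ↥(⋃ i, L i)))
      (fun ⟨l, hl⟩ => ?_) ((hφ v).comp ih)
    obtain ⟨i, hi⟩ := Set.mem_iUnion.1 hl
    exact ⟨⟨i, l, hi⟩, rfl⟩

theorem IsOp.map_of_vertices (φ : R.Edge → T.Edge)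
    (hφ : ∀ v : R.Vertex, T.IsOp (fun i : R.Input v => φ i.edge) (φ (R.out v)))
    {X : Type} {c : X → R.Edge} {e : R.Edge} (h : R.IsOp c e) : T.IsOp (φ ∘ c) (φ e) :=
  (h.2.isOp_map φ hφ).comp_equiv (Equiv.ofInjective c h.1)

/-- A map on edges which sends the vertices of `R` to operations of `Ω(T)` extends to a morphism. -/
def homOfVertices (φ : R.Edge → T.Edge)
    (hφ : ∀ v : R.Vertex, T.IsOp (fun i : R.Input v => φ i.edge) (φ (R.out v))) : R ⟶ T where
  color := φ
  app c e := Discrete.functor (C := Discrete (PLift (T.IsOp (φ ∘ c) (φ e)))) fun h =>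
    ⟨⟨h.down.map_of_vertices φ hφ⟩⟩
  app_unit _ := rfl
  app_relabel _ c e := functor_ext_of_thin (B := Discrete (PLift (T.IsOp (φ ∘ c) (φ e))))
    fun _ => rfl
  app_comp _ e d := functor_ext_of_thin
    (B := Discrete (PLift (T.IsOp (φ ∘ fun p : Σ _, _ => d p.1 p.2) (φ e)))) fun _ => rfl

end Hom

/-! ### Trees with two vertices -/

open Classical in
/-- The tree with leaves `X` and with a single inner edge, which is below the leaves in `p`. -/
noncomputable def twoLevel (X : Type) [Finite X] (p : X → Prop) : DTree where
  Edge := Option (Option X)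
  Vertex := Bool
  root := none
  -- `true` is the root vertex and `false` is the vertex on top of the inner edge `some none`.
  out v := bif v then none else some none
  out_injective := by rintro (_ | _) (_ | _) <;> simp
  target
    | ⟨none, h⟩ => absurd rfl h
    | ⟨some none, _⟩ => true
    | ⟨some (some x), _⟩ => decide ¬ p x
  path_to_root := by
    have h1 : Relation.ReflTransGen (fun f g : Option (Option X) => ∃ h : f ≠ none,
        (bif (match (⟨f, h⟩ : {e : Option (Option X) // e ≠ none}) with
          | ⟨none, h⟩ => absurd rfl h
          | ⟨some none, _⟩ => true
          | ⟨some (some x), _⟩ => decide ¬ p x) then none else some none) = g) (some none) none :=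
      .single ⟨by simp, rfl⟩
    rintro (_ | _ | x)
    · exact .refl
    · exact h1
    · by_cases hx : p x
      · exact .head ⟨by simp, by simp [hx]⟩ h1
      · exact .single ⟨by simp, by simp [hx]⟩

section TwoLevel

variable {X : Type} [Finite X] {p : X → Prop}

theorem card_vertex_twoLevel : Nat.card (twoLevel X p).Vertex = 2 :=
  Nat.card_eq_fintype_card (α := Bool)

/-- The root and the inner edge are outputs of vertices and the edges `some (some x)` are not, so
the latter are all the leaves. This includes the cases where `p` or its complement is empty. -/
theorem twoLevel_isOp :
    (twoLevel X p).IsOp (fun x : X => (some (some x) : Option (Option X))) none := by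
  have hout : ∀ x : X, ∀ v, (twoLevel X p).out v ≠ (some (some x) : Option (Option X)) := by
    rintro x (_ | _) h <;> cases h
  refine ⟨fun x y h => Option.some.inj (Option.some.inj h), isSubtree_iff.2 ⟨fun l _ => le_root _ l, ?_, ?_⟩⟩
  · rintro _ ⟨x, rfl⟩ _ ⟨y, rfl⟩ hne hle
    rcases Relation.ReflTransGen.cases_tail hle with h | ⟨g, _, _, hg⟩
    · exact hne h.symm
    · exact hout y _ hg
  · rintro (_ | _ | x) _ h
    · exact absurd ⟨true, rfl⟩ h
    · exact absurd ⟨false, rfl⟩ h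
    · exact ⟨_, ⟨x, rfl⟩, le_rfl⟩

/-- With `eq_of_mem_inner_twoLevel` this shows that there is exactly one inner edge, so the category
of operations on all the leaves is a single copy of `H`. -/
theorem twoLevel_mem_inner : (some none : Option (Option X)) ∈
    (twoLevel X p).inner (fun x : X => (some (some x) : Option (Option X))) none := by
  refine ⟨Step.lt ⟨nofun, rfl⟩, fun x h => ?_⟩
  rcases Relation.ReflTransGen.cases_tail h with h | ⟨g, _, _, hg⟩
  · cases h
  · revert hg
    generalize (twoLevel X p).target _ = v
    cases v <;> exact nofun

theorem eq_of_mem_inner_twoLevel {f : Option (Option X)} (hf : f ∈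
    (twoLevel X p).inner (fun x : X => (some (some x) : Option (Option X))) none) :
    f = some none := by
  rcases f with _ | _ | x
  · exact absurd hf.1 (lt_irrefl _)
  · rfl
  · exact absurd le_rfl (hf.2 x)

variable {T : DTree}

/-- The map on edges underlying `twoLevelHom`. -/
def twoLevelEdge (c : X → T.Edge) (g e : T.Edge) : Option (Option X) → T.Edge
  | none => e
  | some none => g
  | some (some x) => c x

/-- The morphism from `twoLevel X p` given by two operations of `Ω(T)`, the second one of
which has as output one of the inputs of the first one. -/
noncomputable def twoLevelHom {c : X → T.Edge} {g e : T.Edge}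
    (h : T.IsOp (fun o : Option {x // ¬ p x} => o.elim g fun x => c x) e)
    (h' : T.IsOp (fun x : {x // p x} => c x) g) : twoLevel X p ⟶ T :=
  homOfVertices (twoLevelEdge c g e) fun v => by
    match v with
    | false =>
      -- The inputs of the upper vertex are the leaves in `p`; those of the lower vertex are the
      -- remaining leaves and the inner edge, which is the `none` of the option type.
      refine IsOp.of_surjective (fun x : {x // p x} =>
        (⟨⟨(some (some x.1) : Option (Option X)), nofun⟩, by simp [twoLevel, x.2]⟩ :
          (twoLevel X p).Input false)) ?_ h'
      rintro ⟨⟨_ | _ | x, hx⟩, hx'⟩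
      · exact absurd rfl hx
      · exact absurd hx' nofun
      · exact ⟨⟨x, by simpa [twoLevel] using hx'⟩, rfl⟩
    | true =>
      refine IsOp.of_surjective (fun o : Option {x // ¬ p x} =>
        (⟨⟨(some (o.map Subtype.val) : Option (Option X)), nofun⟩, by
          rcases o with _ | x
          · rfl
          · simp [twoLevel, x.2]⟩ : (twoLevel X p).Input true)) ?_ ?_
      · rintro ⟨⟨_ | _ | x, hx⟩, hx'⟩
        · exact absurd rfl hx
        · exact ⟨none, rfl⟩
        · exact ⟨some ⟨x, by simpa [twoLevel] using hx'⟩, rfl⟩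
      · convert h using 1
        · funext o
          rcases o with _ | x <;> rfl
        · rfl

end TwoLevel

/-! ### Cutting an operation into pieces -/

section Cut

variable {T : DTree} {X X' : Type} {c : X → T.Edge} {c' : X' → T.Edge} {e : T.Edge} {π : X → X'}

/-- A leaf of `T` above `c' x'` lies above some `c x`. It then lies above `c' (π x)` too, and since
the `c'` form an antichain, `π x = x'`. -/
theorem IsOp.fiber (h : T.IsOp c e) (h' : T.IsOp c' e) (hπ : ∀ x, c x ≤ c' (π x)) (x' : X') :
    T.IsOp (fun x : {x // π x = x'} => c x) (c' x') := by
  refine ⟨h.1.comp Subtype.val_injective, isSubtree_iff.2 ⟨?_, ?_, fun f hf hleaf => ?_⟩⟩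
  · rintro _ ⟨⟨x, rfl⟩, rfl⟩
    exact hπ x
  · rintro _ ⟨x, rfl⟩ _ ⟨y, rfl⟩ hne hle
    exact hne (congrArg c (h.eq_of_le hle))
  · obtain ⟨_, ⟨x, rfl⟩, hx⟩ := (isSubtree_iff.1 h.2).2.2 f (hf.trans (h'.le x')) hleaf
    exact ⟨_, ⟨⟨x, h'.eq_of_le_of_le (hx.trans (hπ x)) hf⟩, rfl⟩, hx⟩

/-- This is the lower piece when the subtree is cut at `g`: the leaves above `g` are replaced by `g`
itself. The antichain condition holds because an inner edge is not above any leaf of the subtree. -/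
theorem IsOp.collapse (h : T.IsOp c e) {g : T.Edge} (hg : g ∈ T.inner c e) :
    T.IsOp (fun o : Option {x // ¬ c x ≤ g} => o.elim g fun x => c x) e := by
  have key : ∀ o o' : Option {x // ¬ c x ≤ g},
      (o.elim g fun x => c x) ≤ (o'.elim g fun x => c x) → o = o' := by
    rintro (_ | x) (_ | y) hle
    · rfl
    · exact absurd hle (hg.2 y)
    · exact absurd hle x.2
    · exact congrArg some (Subtype.ext (h.eq_of_le hle))
  refine ⟨fun o o' ho => key o o' ho.le, isSubtree_iff.2 ⟨?_, ?_, fun f hf hleaf => ?_⟩⟩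
  · rintro _ ⟨_ | x, rfl⟩
    · exact hg.1.le
    · exact h.le x
  · rintro _ ⟨o, rfl⟩ _ ⟨o', rfl⟩ hne hle
    exact hne (by rw [key o o' hle])
  · obtain ⟨_, ⟨x, rfl⟩, hx⟩ := (isSubtree_iff.1 h.2).2.2 f hf hleaf
    by_cases hxg : c x ≤ g
    · exact ⟨_, ⟨none, rfl⟩, hx.trans hxg⟩
    · exact ⟨_, ⟨some ⟨x, hxg⟩, rfl⟩, hx⟩

theorem inner_subset (hπ : ∀ x, c x ≤ c' (π x)) : T.inner c' e ⊆ T.inner c e :=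
  fun _ hf => ⟨hf.1, fun x hx => hf.2 (π x) (hx.trans (hπ x))⟩

theorem inner_fiber_subset (h' : T.IsOp c' e) (hπ : ∀ x, c x ≤ c' (π x)) (x' : X') :
    T.inner (fun x : {x // π x = x'} => c x) (c' x') ⊆ T.inner c e :=
  fun _ hf => ⟨hf.1.trans_le (h'.le x'), fun x hx =>
    hf.2 ⟨x, h'.eq_of_le_of_le (hx.trans (hπ x)) hf.1.le⟩ hx⟩

/-- An inner edge of the subtree lies strictly above some `c' x'`, equals one, or is inner in the
lower piece. Composition keeps the length in the first and last cases and forces length `1` in the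
middle one; hence `hℓ`. -/
theorem compLength_cut (h' : T.IsOp c' e) (hπ : ∀ x, c x ≤ c' (π x)) (ℓ : T.inner c e → Bool)
    (hℓ : ∀ x' (hx' : c' x' ∈ T.inner c e), ℓ ⟨c' x', hx'⟩ = true) (f : T.inner c e) :
    T.compLength c' e (fun x' (x : {x // π x = x'}) => c x)
      (fun f => ℓ ⟨f.1, inner_subset hπ f.2⟩)
      (fun x' f => ℓ ⟨f.1, inner_fiber_subset h' hπ x' f.2⟩)
      ⟨f.1, f.2.1, fun p => f.2.2 p.2.1⟩ = ℓ f := by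
  refine Bool.eq_iff_iff.2 ((compLength_iff h' _ _ _).trans
    ⟨fun ⟨h1, h2⟩ => ?_, fun h => ⟨fun _ => h, fun _ _ => h⟩⟩)
  by_cases hf : ∃ x', f.1 ≤ c' x'
  · obtain ⟨x', hx'⟩ := hf
    rcases hx'.lt_or_eq with hlt | heq
    · exact h2 x' ⟨hlt, fun x => f.2.2 x⟩
    · obtain ⟨f, hf⟩ := f
      obtain rfl : f = c' x' := heq
      exact hℓ x' hf
  · push Not at hf
    exact h1 ⟨f.2.1, hf⟩

end Cut

end DTree

/-! ## Functors which agree on all morphisms between two objects -/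

namespace CategoryTheory

section Arrow

variable {C : Type*} [Category C]

/-- An equality in the arrow category also records equality of the endpoints, so functors whose
values on objects are not definitionally equal can be compared without transport. -/
theorem Arrow.mk_comp_congr {X Y Z X' Y' Z' : C} {f : X ⟶ Y} {f' : X' ⟶ Y'} {g : Y ⟶ Z}
    {g' : Y' ⟶ Z'} (hf : Arrow.mk f = Arrow.mk f') (hg : Arrow.mk g = Arrow.mk g') :
    Arrow.mk (f ≫ g) = Arrow.mk (f' ≫ g') := by
  obtain rfl : X = X' := congrArg (fun a : Arrow C => a.left) hf
  obtain rfl : Y = Y' := congrArg (fun a : Arrow C => a.right) hf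
  obtain rfl : Z = Z' := congrArg (fun a : Arrow C => a.right) hg
  rw [Arrow.mk_injective _ _ hf, Arrow.mk_injective _ _ hg]

theorem Arrow.mk_inv_congr {X Y X' Y' : C} {f : X ≅ Y} {f' : X' ≅ Y'}
    (hf : Arrow.mk f.hom = Arrow.mk f'.hom) : Arrow.mk f.inv = Arrow.mk f'.inv := by
  obtain rfl : X = X' := congrArg (fun a : Arrow C => a.left) hf
  obtain rfl : Y = Y' := congrArg (fun a : Arrow C => a.right) hf
  rw [Iso.ext (Arrow.mk_injective _ _ hf)]

theorem Arrow.mk_prod_congr {D : Type*} [Category D] {X Y X' Y' : C × D} {f : X ⟶ Y}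
    {f' : X' ⟶ Y'} (h₁ : Arrow.mk f.1 = Arrow.mk f'.1) (h₂ : Arrow.mk f.2 = Arrow.mk f'.2) :
    Arrow.mk f = Arrow.mk f' := by
  obtain rfl : X = X' := Prod.ext (congrArg (fun a : Arrow C => a.left) h₁)
    (congrArg (fun a : Arrow D => a.left) h₂)
  obtain rfl : Y = Y' := Prod.ext (congrArg (fun a : Arrow C => a.right) h₁)
    (congrArg (fun a : Arrow D => a.right) h₂)
  exact congrArg Arrow.mk (Prod.ext (Arrow.mk_injective _ _ h₁) (Arrow.mk_injective _ _ h₂))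

theorem Arrow.mk_pi_congr {I : Type*} {C : I → Type*} [∀ i, Category (C i)] {X Y X' Y' : ∀ i, C i}
    {f : X ⟶ Y} {f' : X' ⟶ Y'} (h : ∀ i, Arrow.mk (f i) = Arrow.mk (f' i)) :
    Arrow.mk f = Arrow.mk f' := by
  obtain rfl : X = X' := funext fun i => congrArg (fun a : Arrow (C i) => a.left) (h i)
  obtain rfl : Y = Y' := funext fun i => congrArg (fun a : Arrow (C i) => a.right) (h i)
  exact congrArg Arrow.mk (funext fun i => Arrow.mk_injective _ _ (h i))

end Arrow

/-- Two functors agree on all morphisms from `a` to `b`. -/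
def AgreeBetween {C D : Type*} [Category C] [Category D] (A B : C ⥤ D) (a b : C) : Prop :=
  ∀ f : a ⟶ b, Arrow.mk (A.map f) = Arrow.mk (B.map f)

namespace AgreeBetween

variable {C C' D D' : Type*} [Category C] [Category C'] [Category D] [Category D']
  {A B : C ⥤ D} {a b d : C}

/-- Thinness of the source makes every arrow from `a` to `d` the composite through `b`. -/
theorem trans [Quiver.IsThin C] (h : AgreeBetween A B a b) (h' : AgreeBetween A B b d)
    (f : a ⟶ b) (g : b ⟶ d) : AgreeBetween A B a d := fun k => by
  rw [Subsingleton.elim k (f ≫ g), A.map_comp, B.map_comp]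
  exact Arrow.mk_comp_congr (h f) (h' g)

theorem symm [Quiver.IsThin C] (h : AgreeBetween A B a b) (f : a ≅ b) :
    AgreeBetween A B b a := fun k => by
  rw [Subsingleton.elim k f.inv]
  exact Arrow.mk_inv_congr (f := A.mapIso f) (f' := B.mapIso f) (h f.hom)

/-- Compatibility of operad maps with relabelling and with composition is a square of this kind;
agreement on the pieces is thereby carried to the composite operation. -/
theorem of_square [Quiver.IsThin C] {A' B' : C' ⥤ D'} {K : C' ⥤ C} {L : D' ⥤ D} {a b : C'}
    (hA : K ⋙ A = A' ⋙ L) (hB : K ⋙ B = B' ⋙ L) (h : AgreeBetween A' B' a b) (f : a ⟶ b) :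
    AgreeBetween A B (K.obj a) (K.obj b) := fun k => by
  rw [Subsingleton.elim k (K.map f)]
  exact (congrArg (fun Φ : C' ⥤ D => Arrow.mk (Φ.map f)) hA).trans
    ((congrArg L.mapArrow.obj (h f)).trans
      (congrArg (fun Φ : C' ⥤ D => Arrow.mk (Φ.map f)) hB).symm)

theorem of_comp_eq [Quiver.IsThin C] {K : C' ⥤ C} {a b : C'} (h : K ⋙ A = K ⋙ B) (f : a ⟶ b) :
    AgreeBetween A B (K.obj a) (K.obj b) := fun k => by
  rw [Subsingleton.elim k (K.map f)]
  exact congrArg (fun Φ : C' ⥤ D => Arrow.mk (Φ.map f)) h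

theorem prod {A' B' : C' ⥤ D'} {x y : C × C'} (h : AgreeBetween A B x.1 y.1)
    (h' : AgreeBetween A' B' x.2 y.2) : AgreeBetween (A.prod A') (B.prod B') x y :=
  fun f => Arrow.mk_prod_congr (h f.1) (h' f.2)

theorem pi {I : Type*} {C D : I → Type*} [∀ i, Category (C i)] [∀ i, Category (D i)]
    {A B : ∀ i, C i ⥤ D i} {x y : ∀ i, C i} (h : ∀ i, AgreeBetween (A i) (B i) (x i) (y i)) :
    AgreeBetween (Functor.pi A) (Functor.pi B) x y :=
  fun f => Arrow.mk_pi_congr fun i => h i (f i)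

theorem functor_eq (h : ∀ a b, AgreeBetween A B a b) : A = B := by
  -- Agreement on the identity of `a` gives agreement on the object `a`.
  refine CategoryTheory.Functor.hext
    (fun a => congrArg (fun k : Arrow D => k.left) (h a a (𝟙 a))) fun a b f => ?_
  exact congr_arg_heq (fun k : Arrow D => k.hom) (h a b f)

end AgreeBetween

end CategoryTheory

/-! ## Maps out of the `W`-construction -/

namespace DTree

instance W.partialOrder (T : DTree) : PartialOrder T.W.Color :=
  inferInstanceAs (PartialOrder T.Edge)

section

variable {T : DTree} {X : Type} [Finite X] {c : X → T.W.Color} {e : T.W.Color}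

instance W.isThin : Quiver.IsThin (T.W.Op c e) :=
  inferInstanceAs (Quiver.IsThin (Discrete (PLift (T.IsOp c e)) × (T.inner c e → H)))

/-- The operation of `W(Ω(T))` with given lengths of the inner edges. -/
def W.op (h : T.IsOp c e) (ℓ : T.inner c e → Bool) : T.W.Op c e :=
  ((⟨⟨h⟩⟩, fun f => ⟨ℓ f⟩) : Discrete (PLift (T.IsOp c e)) × (T.inner c e → H))

theorem W.exists_eq_op (a : T.W.Op c e) : ∃ h ℓ, a = W.op (T := T) (c := c) (e := e) h ℓ :=
  ⟨a.1.as.down, fun f => (a.2 f).as, rfl⟩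

/-- Any two operations of the same signature are isomorphic. -/
def W.iso (a b : T.W.Op c e) : a ≅ b where
  hom := (⟨eqToHom (Subsingleton.elim (α := Discrete (PLift (T.IsOp c e))) _ _),
    fun _ => (Codiscrete.iso _ _).hom⟩ :
      (show Discrete (PLift (T.IsOp c e)) × (T.inner c e → H) from a) ⟶ b)
  inv := (⟨eqToHom (Subsingleton.elim (α := Discrete (PLift (T.IsOp c e))) _ _),
    fun _ => (Codiscrete.iso _ _).hom⟩ :
      (show Discrete (PLift (T.IsOp c e)) × (T.inner c e → H) from b) ⟶ a)
  hom_inv_id := Subsingleton.elim _ _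
  inv_hom_id := Subsingleton.elim _ _

/-- Cutting along edges of length `1` loses nothing: the operation is the composite of its pieces
with the restricted lengths. The composite has its inputs indexed by the fibres of `π`, whence the
relabelling. -/
theorem W.op_eq_relabel_comp {X' : Type} [Finite X'] {c' : X' → T.W.Color} {π : X → X'}
    (h : T.IsOp c e) (h' : T.IsOp c' e) (hπ : ∀ x, c x ≤ c' (π x)) (ℓ : T.inner c e → Bool)
    (hℓ : ∀ x' (hx' : c' x' ∈ T.inner c e), ℓ ⟨c' x', hx'⟩ = true) :
    W.op h ℓ = (T.W.relabel (Equiv.sigmaFiberEquiv π) c e).obj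
      ((T.W.comp c' e (fun x' (x : {x // π x = x'}) => c x)).obj
        (W.op h' fun f => ℓ ⟨f.1, inner_subset hπ f.2⟩,
          fun x' => W.op (h.fiber h' hπ x') fun f => ℓ ⟨f.1, inner_fiber_subset h' hπ x' f.2⟩)) :=
  Prod.ext rfl (funext fun f => congrArg Codiscrete.mk (compLength_cut h' hπ ℓ hℓ f).symm)

end

open CatOperad

/-! ### Arrows of the cube coming from trees with two vertices -/

section Restriction

/-- The leaves of `twoLevel X p` as colours of `W(Ω(twoLevel X p))`. -/
def W.twoLevelLeaf {X : Type} [Finite X] (p : X → Prop) (x : X) : (twoLevel X p).W.Color :=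
  (some (some x) : Option (Option X))

/-- The root of `twoLevel X p` as a colour of `W(Ω(twoLevel X p))`. -/
def W.twoLevelRoot {X : Type} [Finite X] (p : X → Prop) : (twoLevel X p).W.Color :=
  (none : Option (Option X))

/-- The operation of `W(Ω(twoLevel X p))` on all leaves with a given length of the inner edge. -/
noncomputable def W.twoLevelOp {X : Type} [Finite X] (p : X → Prop) (b : Bool) :
    (twoLevel X p).W.Op (W.twoLevelLeaf p) (W.twoLevelRoot p) :=
  W.op twoLevel_isOp fun _ => b

variable {T : DTree} {X : Type} [Finite X] {p : X → Prop} {c : X → T.W.Color} {g e : T.W.Color}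
  (h : T.IsOp (fun o : Option {x // ¬ p x} => o.elim g fun x => c x) e)
  (h' : T.IsOp (fun x : {x // p x} => c x) g)

-- The induced length at `f` is a maximum over the inner edges mapped to `f`, and the only candidate
-- is `some none`, which is mapped to `g`. So `false` gives the origin and `true` the indicator of
-- `g`.
open Classical in
theorem W.map_twoLevelHom_op (hop : T.IsOp c e) (b : Bool) :
    ((W.map (twoLevelHom h h')).app (W.twoLevelLeaf p) (W.twoLevelRoot p)).obj
      (W.twoLevelOp p b) = W.op hop fun f => b && decide (f.1 = g) := by
  refine Prod.ext rfl (funext fun f => congrArg Codiscrete.mk (Bool.eq_iff_iff.2 ?_))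
  refine mapLength_iff.trans ?_
  rw [Bool.and_eq_true, decide_eq_true_iff]
  constructor
  · rintro ⟨⟨k, hk⟩, hkf, hb⟩
    obtain rfl := eq_of_mem_inner_twoLevel hk
    exact ⟨hb, hkf.symm⟩
  · exact fun ⟨hb, hf⟩ => ⟨⟨some none, twoLevel_mem_inner⟩, hf.symm, hb⟩

end Restriction

theorem _root_.CatOperad.Hom.app_heq {P : CatOperad.{u, w, v}} {Q : CatOperad.{u', w', v'}}
    {F G : Hom P Q} (h : F = G) {X : Type} [Finite X] (c : X → P.Color) (e : P.Color) :
    HEq (F.app c e) (G.app c e) := by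
  rw [h]

/-- The only index is `none`, so this is a unit. It gives degenerate two-vertex trees in `T`, whose
lower vertex is sent to the identity of `e`. -/
theorem isOp_elim_of_forall {T : DTree} {X : Type} {p : X → Prop} (hp : ∀ x, p x)
    (c : X → T.Edge) (e : T.Edge) :
    T.IsOp (fun o : Option {x // ¬ p x} => o.elim e fun x => c x) e :=
  IsOp.of_surjective (fun _ : Unit => none)
    (by rintro (_ | ⟨x, h⟩); exacts [⟨(), rfl⟩, absurd (hp x) h]) (IsOp.unit e)

/-! ### Determination by two-vertex trees -/

section Extension

variable {T : DTree} {P : CatOperad.{u, w, v}} {col : T.W.Color → P.Color}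
  {A B : ∀ {X : Type} [Finite X] (c : X → T.W.Color) (e : T.W.Color),
    T.W.Op c e ⥤ P.Op (col ∘ c) (col e)}

/-- If both ends have length `1` along the cut, then by thinness the arrow between them is the
relabelled composite of arrows between the pieces, so agreement on the pieces suffices. The maps
enter as families `A`, `B` over one colour map `col`, so that their values lie in the same
categories. -/
theorem W.agreeBetween_of_cut
    (hA : ∀ {X Y : Type} [Finite X] [Finite Y] (φ : X ≃ Y) (c : Y → T.W.Color) (e : T.W.Color),
      T.W.relabel φ c e ⋙ A c e = A (c ∘ φ) e ⋙ P.relabel φ (col ∘ c) (col e))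
    (hB : ∀ {X Y : Type} [Finite X] [Finite Y] (φ : X ≃ Y) (c : Y → T.W.Color) (e : T.W.Color),
      T.W.relabel φ c e ⋙ B c e = B (c ∘ φ) e ⋙ P.relabel φ (col ∘ c) (col e))
    (hA' : ∀ {X : Type} [Finite X] {Y : X → Type} [∀ x, Finite (Y x)] (c : X → T.W.Color)
      (e : T.W.Color) (d : ∀ x, Y x → T.W.Color),
      T.W.comp c e d ⋙ A (fun p : Σ x, Y x => d p.1 p.2) e =
        (A c e).prod (Functor.pi fun x => A (d x) (c x)) ⋙
          P.comp (col ∘ c) (col e) (fun x => col ∘ d x))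
    (hB' : ∀ {X : Type} [Finite X] {Y : X → Type} [∀ x, Finite (Y x)] (c : X → T.W.Color)
      (e : T.W.Color) (d : ∀ x, Y x → T.W.Color),
      T.W.comp c e d ⋙ B (fun p : Σ x, Y x => d p.1 p.2) e =
        (B c e).prod (Functor.pi fun x => B (d x) (c x)) ⋙
          P.comp (col ∘ c) (col e) (fun x => col ∘ d x))
    {X X' : Type} [Finite X] [Finite X'] {c : X → T.W.Color} {e : T.W.Color}
    {c' : X' → T.W.Color} {π : X → X'}
    (h : T.IsOp c e) (h' : T.IsOp c' e) (hπ : ∀ x, c x ≤ c' (π x))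
    (IH : ∀ a b, AgreeBetween (A c' e) (B c' e) a b)
    (IH' : ∀ x' a b, AgreeBetween (A (fun x : {x // π x = x'} => c x) (c' x'))
      (B (fun x : {x // π x = x'} => c x) (c' x')) a b)
    {ℓ ℓ' : T.inner c e → Bool}
    (hℓ : ∀ x' (hx' : c' x' ∈ T.inner c e), ℓ ⟨c' x', hx'⟩ = true)
    (hℓ' : ∀ x' (hx' : c' x' ∈ T.inner c e), ℓ' ⟨c' x', hx'⟩ = true) :
    AgreeBetween (A c e) (B c e) (W.op h ℓ) (W.op h ℓ') := by
  rw [W.op_eq_relabel_comp h h' hπ ℓ hℓ, W.op_eq_relabel_comp h h' hπ ℓ' hℓ']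
  refine AgreeBetween.of_square (hA _ _ _) (hB _ _ _) ?_ (W.iso _ _).hom
  exact AgreeBetween.of_square (hA' _ _ _) (hB' _ _ _)
    (AgreeBetween.prod (IH _ _) (AgreeBetween.pi fun x' => IH' x' _ _))
    ⟨(W.iso _ _).hom, fun _ => (W.iso _ _).hom⟩

end Extension

/-- Maps out of `W(Ω(T))` are equal if they become equal after restriction to the trees with two
vertices. -/
theorem W.hom_ext_of_twoLevel {T : DTree} {P : CatOperad.{u, w, v}} {F G : Hom T.W P}
    (h : ∀ (X : Type) [Finite X] (p : X → Prop) (δ : twoLevel X p ⟶ T),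
      (W.map δ).comp F = (W.map δ).comp G) : F = G := by
  classical
  obtain ⟨col, A, hA, hAr, hAc⟩ := F
  obtain ⟨col', B, hB, hBr, hBc⟩ := G
  -- The colour at `g` is read off at the root of the unary two-vertex tree all of whose edges are
  -- sent to `g`.
  obtain rfl : col = col' := by
    funext g
    have h1 : T.IsOp (fun _ : {x : Unit // True} => (g : T.Edge)) g :=
      (IsOp.unit g).comp_equiv (Equiv.subtypeUnivEquiv fun _ => trivial)
    exact congrFun (congrArg Hom.color (h Unit (fun _ => True)
      (twoLevelHom (c := fun _ => g) (isOp_elim_of_forall (fun _ => trivial) (fun _ : Unit => g) g) h1)))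
      (W.twoLevelRoot _)
  -- Agreement on the arrows that come from two-vertex trees: from the origin to itself (`b =
  -- false`) or to the indicator of `g` (`b = true`).
  have hδ : ∀ {X : Type} [Finite X] (p : X → Prop) {c : X → T.W.Color} {g e : T.W.Color}
      (_ : T.IsOp (fun o : Option {x // ¬ p x} => o.elim g fun x => c x) e)
      (_ : T.IsOp (fun x : {x // p x} => c x) g) (hop : T.IsOp c e) (b : Bool),
      AgreeBetween (A c e) (B c e) (W.op hop fun _ => false)
        (W.op hop fun f => b && decide (f.1 = g)) := fun {X} _ p c g e h1 h2 hop b => by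
    have h3 := eq_of_heq (Hom.app_heq (h X p (twoLevelHom h1 h2)) (W.twoLevelLeaf p)
      (W.twoLevelRoot p))
    have h4 := AgreeBetween.of_comp_eq (A := A c e) (B := B c e) h3
      (W.iso (W.twoLevelOp p false) (W.twoLevelOp p b)).hom
    have h5 := W.map_twoLevelHom_op h1 h2 hop false
    simp only [Bool.false_and] at h5
    exact h5 ▸ W.map_twoLevelHom_op h1 h2 hop b ▸ h4
  -- Strong induction on the number of inner edges, for all signatures at once, because cutting
  -- changes both inputs and output.
  have key : ∀ (n : ℕ) {X : Type} [Finite X] (c : X → T.W.Color) (e : T.W.Color),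
      (T.inner c e).ncard = n → ∀ a b, AgreeBetween (A c e) (B c e) a b := by
    intro n
    induction n using Nat.strong_induction_on with
    | _ n ih =>
      intro X _ c e hn
      have step : ∀ (hop : T.IsOp c e) (ℓ : T.inner c e → Bool),
          AgreeBetween (A c e) (B c e) (W.op hop fun _ => false) (W.op hop ℓ) := by
        intro hop ℓ
        by_cases hℓ : ∃ g, ℓ g = true
        · obtain ⟨⟨g, hg⟩, hgℓ⟩ := hℓ
          -- The cut at `g` alone: all the inputs above `g` go to `none`, and each other input forms
          -- a trivial piece of its own.
          let π : X → Option {x // ¬ c x ≤ g} := fun x =>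
            if hx : c x ≤ g then none else some ⟨x, hx⟩
          let c' : Option {x // ¬ c x ≤ g} → T.W.Color := fun o => o.elim g fun x => c x
          have hπ : ∀ x, c x ≤ c' (π x) := fun x => by
            by_cases hx : c x ≤ g
            · rw [show π x = none from dif_pos hx]
              exact hx
            · rw [show π x = some ⟨x, hx⟩ from dif_neg hx]
              exact le_rfl
          have hc' : T.IsOp c' e := hop.collapse hg
          have h2 := hop.fiber hc' hπ none
          have h1 : T.IsOp (fun x : {x // c x ≤ g} => c x) g :=
            h2.comp_equiv (Equiv.subtypeEquivRight fun x => by simp [π])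
          have hlt : ∀ S : Set T.Edge, S ⊆ T.inner c e → g ∉ S → S.ncard < n := fun S hS hgS =>
            hn ▸ Set.ncard_lt_ncard ⟨hS, fun h => hgS (h hg)⟩
          -- The other inputs of the lower piece are leaves of the subtree, hence not inner, so the
          -- length condition of the cut concerns `g` only.
          have hmem : ∀ x' (hx' : c' x' ∈ T.inner c e), c' x' = g := by
            rintro (_ | x) hx'
            · rfl
            · exact absurd le_rfl (hx'.2 x)
          -- The path from the origin to `ℓ` through the indicator of `g`; its second half has
          -- length `1` at `g` throughout.
          refine (hδ _ hc' h1 hop true).trans ?_ (W.iso _ _).hom (W.iso _ _).hom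
          refine W.agreeBetween_of_cut hAr hBr hAc hBc hop hc' hπ (ih _ ?_ c' e rfl)
            (fun x' => ih _ ?_ _ _ rfl) (fun x' hx' => ?_) (fun x' hx' => ?_)
          -- In the lower piece `g` is a leaf and no longer inner.
          · exact hlt _ (inner_subset hπ) fun h => h.2 none le_rfl
          -- If `g` were inner in the piece over `x'`, it would lie strictly above `c' x'`. The
          -- antichain condition then gives `x' = none`, that is `g < g`.
          · refine hlt _ (inner_fiber_subset hc' hπ x') fun h => ?_
            obtain rfl : none = x' := hc'.eq_of_le h.1.le
            exact lt_irrefl _ h.1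
          · simp [hmem x' hx']
          · rw [← hgℓ]
            exact congrArg ℓ (Subtype.ext (hmem x' hx'))
        -- Here `ℓ` is the origin. A degenerate two-vertex tree with all leaves on the upper vertex
        -- gives agreement there; it exists even if the subtree has no inner edge.
        · have : ℓ = fun f => false && decide (f.1 = e) := by
            funext f
            simpa using fun hf => hℓ ⟨f, hf⟩
          rw [this]
          exact hδ (fun _ => True) (isOp_elim_of_forall (fun _ => trivial) c e)
            (hop.comp_equiv (Equiv.subtypeUnivEquiv fun _ => trivial)) hop false
      intro a b
      obtain ⟨hop, ℓ, rfl⟩ := W.exists_eq_op a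
      obtain ⟨_, ℓ', rfl⟩ := W.exists_eq_op b
      -- Every arrow factors through the origin, the first half being the inverse of an arrow out of
      -- it.
      exact ((step hop ℓ).symm (W.iso _ _)).trans (step hop ℓ') (W.iso _ _).hom (W.iso _ _).hom
  refine Hom.ext' rfl fun c e => heq_of_eq (AgreeBetween.functor_eq (key _ c e rfl))

end DTree

theorem mainTheorem4 (T : DTree) (hT : 3 ≤ Nat.card T.Vertex)
    (t s : wCatOne.{u, v}.obj (Opposite.op T))
    (h : Sk.{max (u + 1) (v + 1)} 2 t = Sk.{max (u + 1) (v + 1)} 2 s) : t = s := by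
  exact DTree.W.hom_ext_of_twoLevel (F := t) (G := s) fun X _ p δ =>
    map_eq_of_Sk_eq h DTree.card_vertex_twoLevel.le δ
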